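/- Let $G_N=N^{-1/2}G$, where $G$ is an $N\times N$ matrix of i.i.d. standard complex normal random variables (real and imaginary parts independent centred Gaussians of variance $1/2$). Let $L>0$ and let $k\ge 0$ be an integer. Then, as $N\to\infty$, uniformly for $z\in\mathbb C$ with $|z|\le 1+L/\sqrt N$, $$\mathbb E\,|\det(G_N-z)|^{2k}=e^{Nk(|z|^2-1)+\frac{k^2}{2}\log N}\,\frac{(2\pi)^{k/2}}{G(1+k)}\,F_k\big(\sqrt N(1-|z|^2)\big)\,(1+o(1)),$$ that is, for every $\varepsilon>0$ there is $N_0=N_0(L,k,\varepsilon)$ such that for all $N\ge N_0$ and all such $z$ the equality holds with a factor $1+\delta$, $|\delta|\le\varepsilon$, in place of $1+o(1)$. Here $G(1+k)$ is the value at $1+k$ of the Barnes $G$-function and $F_k(x)=\mathbb P(\lambda_{\max}<x)$ is the distribution function of the largest eigenvalue $\lambda_{\max}$ of a $k\times k$ GUE matrix, i.e. a random Hermitian matrix $H$ with density proportional to $e^{-\mathrm{Tr}(H^2)/2}$ with respect to the Lebesgue measure on its functionally independent entries (for $k=0$, $F_0\equiv 1$). -/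

import Mathlib

open MeasureTheory ProbabilityTheory Filter

noncomputable section

/-- The law of a standard complex normal random variable `X + iY`, where `X` and `Y` are
independent real centred Gaussian variables of variance `1/2`. -/
def stdComplexNormal : Measure ℂ :=
  ((gaussianReal 0 (1 / 2)).prod (gaussianReal 0 (1 / 2))).map
    (fun p : ℝ × ℝ => (p.1 : ℂ) + (p.2 : ℂ) * Complex.I)

instance instIsProbabilityMeasureStdComplexNormal : IsProbabilityMeasure stdComplexNormal := by
  unfold stdComplexNormal
  exact Measure.isProbabilityMeasure_map (by fun_prop)

/-- The joint law of an `N × N` array of i.i.d. standard complex normal random variables. -/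
def iidComplexNormal (N : ℕ) : Measure (Fin N → Fin N → ℂ) :=
  Measure.pi fun _ => Measure.pi fun _ => stdComplexNormal

instance instIsProbabilityMeasureIidComplexNormal (N : ℕ) :
    IsProbabilityMeasure (iidComplexNormal N) := by
  unfold iidComplexNormal
  infer_instance

/-- The complex Ginibre matrix `G_N = N^{-1/2} G`, as a function of the array `G` of entries. -/
def ginibreMatrix (N : ℕ) (g : Fin N → Fin N → ℂ) : Matrix (Fin N) (Fin N) ℂ :=
  ((Real.sqrt N : ℝ) : ℂ)⁻¹ • Matrix.of g

/-- The moment `𝔼 |det (G_N - z)|^{2k}` of the characteristic polynomial of the complex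
Ginibre matrix. -/
def ginibreMoment (N k : ℕ) (z : ℂ) : ℝ :=
  ∫ g, ‖(ginibreMatrix N g - z • (1 : Matrix (Fin N) (Fin N) ℂ)).det‖ ^ (2 * k)
    ∂(iidComplexNormal N)

/-- The functionally independent entries of a `k × k` Hermitian matrix: the real diagonal entries
and the complex entries strictly above the diagonal. The measure `volume` on this type is the
Lebesgue measure in the real diagonal entries and in the real and imaginary parts of the
others. -/
abbrev HermitianEntries (k : ℕ) : Type :=
  (Fin k → ℝ) × ({p : Fin k × Fin k // p.1 < p.2} → ℂ)

/-- The Hermitian matrix with the given functionally independent entries. -/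
def hermitianOfEntries {k : ℕ} (h : HermitianEntries k) : Matrix (Fin k) (Fin k) ℂ :=
  Matrix.of fun i j =>
    if hij : i < j then h.2 ⟨(i, j), hij⟩
    else if hji : j < i then (starRingEnd ℂ) (h.2 ⟨(j, i), hji⟩)
    else (h.1 i : ℂ)

theorem isHermitian_hermitianOfEntries {k : ℕ} (h : HermitianEntries k) :
    (hermitianOfEntries h).IsHermitian := by
  ext i j
  simp only [hermitianOfEntries, Matrix.conjTranspose_apply, Matrix.of_apply]
  rcases lt_trichotomy i j with hij | rfl | hij
  · simp [hij, hij.not_gt]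
  · simp
  · simp [hij, hij.not_gt]

/-- The unnormalized GUE measure: density `exp (-Tr(H²)/2)` with respect to the Lebesgue measure
on the functionally independent entries of `H`. -/
def gueWeight (k : ℕ) : Measure (HermitianEntries k) :=
  volume.withDensity fun h =>
    ENNReal.ofReal
      (Real.exp (-(Matrix.trace (hermitianOfEntries h * hermitianOfEntries h)).re / 2))

/-- The law of a `k × k` GUE matrix: `gueWeight k` normalized to total mass one. -/
def gueLaw (k : ℕ) : Measure (HermitianEntries k) :=
  (gueWeight k Set.univ)⁻¹ • gueWeight k

/-- The largest eigenvalue of the Hermitian matrix with entries `h`. (Extended-real valued only so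
that the largest eigenvalue of the empty matrix is `-∞`.) -/
def largestEigenvalue {k : ℕ} (h : HermitianEntries k) : EReal :=
  ⨆ i, ((isHermitian_hermitianOfEntries h).eigenvalues i : EReal)

/-- The distribution function `F_k(x) = ℙ(λ_max < x)` of the largest eigenvalue of a `k × k` GUE
matrix. -/
def gueMaxCDF (k : ℕ) (x : ℝ) : ℝ :=
  (gueLaw k).real {h | largestEigenvalue h < (x : EReal)}

/-- The Barnes `G`-function at a real argument `x = 1 + w`, by its Weierstrass product
`G(1+w) = (2π)^{w/2} exp(-(w + (1+γ)w²)/2) ∏_{n ≥ 1} (1 + w/n)^n exp(w²/(2n) - w)`. -/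
def barnesG (x : ℝ) : ℝ :=
  (2 * Real.pi) ^ ((x - 1) / 2) *
    Real.exp (-((x - 1) + (1 + Real.eulerMascheroniConstant) * (x - 1) ^ 2) / 2) *
    ∏' n : ℕ, ((1 + (x - 1) / ((n : ℝ) + 1)) ^ (n + 1) *
      Real.exp ((x - 1) ^ 2 / (2 * ((n : ℝ) + 1)) - (x - 1)))

end

/-!
The determinant of a matrix is the value, at a power of a linear form in one commuting variable per
entry, of a linear functional on polynomials. For a Gaussian matrix the expected power of the linear
form is a polynomial in the form of the mean and in the quadratic form of the covariance, and modulo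
the ideal of polynomials all of whose multiples the functional annihilates, rows and columns
anticommute. Hence the expected determinant only depends on the covariance modulo this ideal. The
matrix `diag (G - z, (G - z)ᴴ)` with `k` copies of each block has the same covariance, in this
sense, as `N` copies of a matrix built from a `k × k` Gaussian matrix `W`, whence
`𝔼 |det (G_N - z)| ^ (2k) = 𝔼 det (|z|² + W Wᴴ / N) ^ N`.

The change of variables `H = W Wᴴ` replaces the right-hand side by an integral over positive
definite `k × k` matrices against `exp (-tr H)`. Substituting
`H = N (1 - |z|²) + √N H'` turns the integrand into the product over the eigenvalues `u` of `H'` of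
`(1 + u / √N) ^ N * exp (-√N u)`, which tends to `exp (-u² / 2)` in `L¹`, and the domain into
`H' > -√N (1 - |z|²)`, that is `λ_max (-H') < √N (1 - |z|²)`. As `|z| ≤ 1 + L / √N` bounds
`√N (1 - |z|²)` from below, the limiting integral over this domain is bounded below, and
convergence in `L¹` yields a uniform relative error.
-/

noncomputable section

open scoped ENNReal ComplexConjugate Topology

section BarnesG

/-- The `n`-th factor of the Weierstrass product of the Barnes function at `1 + w`. -/
def barnesFactor (w : ℝ) (n : ℕ) : ℝ :=
  (1 + w / ((n : ℝ) + 1)) ^ (n + 1) * Real.exp (w ^ 2 / (2 * ((n : ℝ) + 1)) - w)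

theorem barnesG_eq_tprod_barnesFactor (x : ℝ) :
    barnesG x = (2 * Real.pi) ^ ((x - 1) / 2) *
      Real.exp (-((x - 1) + (1 + Real.eulerMascheroniConstant) * (x - 1) ^ 2) / 2) *
      ∏' n, barnesFactor (x - 1) n :=
  rfl

theorem one_add_div_natCast_add_one_pos {w : ℝ} (hw : -1 < w) (n : ℕ) :
    0 < 1 + w / ((n : ℝ) + 1) := by
  have hn : (0 : ℝ) < n + 1 := by positivity
  rw [one_add_div hn.ne']
  exact div_pos (by linarith [n.cast_nonneg (α := ℝ)]) hn

theorem barnesFactor_pos {w : ℝ} (hw : -1 < w) (n : ℕ) : 0 < barnesFactor w n :=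
  mul_pos (pow_pos (one_add_div_natCast_add_one_pos hw n) _) (Real.exp_pos _)

theorem log_barnesFactor {w : ℝ} (hw : -1 < w) (n : ℕ) :
    Real.log (barnesFactor w n) =
      (n + 1) * (Real.log (1 + w / ((n : ℝ) + 1)) - w / ((n : ℝ) + 1) +
        (w / ((n : ℝ) + 1)) ^ 2 / 2) := by
  have hpos := one_add_div_natCast_add_one_pos hw n
  rw [barnesFactor, Real.log_mul (by positivity) (by positivity), Real.log_pow, Real.log_exp]
  push_cast
  field_simp
  ring

theorem abs_log_one_add_sub_add_sq_div_two_le {t : ℝ} (ht : |t| ≤ 1 / 2) :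
    |Real.log (1 + t) - t + t ^ 2 / 2| ≤ 2 * |t| ^ 3 := by
  have h := Real.abs_log_sub_add_sum_range_le (x := -t) (by rw [abs_neg]; linarith) 2
  have hcube : |t| ^ 3 / (1 - |t|) ≤ 2 * |t| ^ 3 := by
    rw [div_le_iff₀ (by linarith)]
    nlinarith [pow_nonneg (abs_nonneg t) 3]
  refine le_trans (le_of_eq ?_) (h.trans (by simpa using hcube))
  simp only [Finset.sum_range_succ, Finset.sum_range_zero]
  norm_num
  ring_nf

theorem multipliable_barnesFactor {w : ℝ} (hw : -1 < w) : Multipliable (barnesFactor w) := by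
  refine Real.multipliable_of_summable_log (barnesFactor_pos hw) ?_
  have hs : Summable fun n : ℕ => 2 * |w| ^ 3 * (1 / ((n : ℝ) + 1) ^ 2) :=
    Summable.mul_left _ (by
      exact_mod_cast (summable_nat_add_iff 1).2 (Real.summable_one_div_nat_pow.2 one_lt_two))
  refine summable_of_isBigO_nat hs (Asymptotics.IsBigO.of_bound 1 ?_)
  filter_upwards [eventually_ge_atTop ⌈2 * |w|⌉₊] with n hn
  have hn' : 2 * |w| ≤ n := Nat.ceil_le.1 hn
  have hp : (0 : ℝ) < n + 1 := by positivity
  have habs : |w / ((n : ℝ) + 1)| = |w| / (n + 1) := by rw [abs_div, abs_of_pos hp]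
  have hlog := abs_log_one_add_sub_add_sq_div_two_le (t := w / ((n : ℝ) + 1))
    (by rw [habs, div_le_iff₀ hp]; linarith)
  rw [log_barnesFactor hw, one_mul, Real.norm_eq_abs, Real.norm_of_nonneg (by positivity), abs_mul,
    abs_of_pos hp]
  refine (mul_le_mul_of_nonneg_left hlog hp.le).trans (le_of_eq ?_)
  rw [habs]
  field_simp

theorem barnesFactor_div_barnesFactor_sub_one (x : ℝ) (n : ℕ) :
    barnesFactor x n / barnesFactor (x - 1) n =
      ((n + 1 + x) / (n + x)) ^ (n + 1) * Real.exp ((x - 1 / 2) * ((n : ℝ) + 1)⁻¹ - 1) := by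
  have hn : (n : ℝ) + 1 ≠ 0 := by positivity
  have hexp : Real.exp (x ^ 2 / (2 * ((n : ℝ) + 1)) - x) /
      Real.exp ((x - 1) ^ 2 / (2 * ((n : ℝ) + 1)) - (x - 1)) =
        Real.exp ((x - 1 / 2) * ((n : ℝ) + 1)⁻¹ - 1) := by
    rw [← Real.exp_sub]
    congr 1
    field_simp
    ring
  rw [barnesFactor, barnesFactor, mul_div_mul_comm, hexp, ← div_pow, one_add_div hn,
    one_add_div hn, div_div_div_cancel_right₀ hn]
  congr 3
  ring

theorem prod_barnesFactor {x : ℝ} (hx : 0 < x) (M : ℕ) :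
    ∏ n ∈ Finset.range M, barnesFactor x n =
      (∏ n ∈ Finset.range M, barnesFactor (x - 1) n) *
        ((M + x) ^ M / (∏ j ∈ Finset.range M, (x + j)) *
          Real.exp ((x - 1 / 2) * harmonic M - M)) := by
  induction M with
  | zero => simp
  | succ M ih =>
    have hM : (M : ℝ) + x ≠ 0 := by positivity
    have hprod : ∏ j ∈ Finset.range M, (x + j) ≠ 0 :=
      Finset.prod_ne_zero_iff.2 fun j _ => by positivity
    have hexp : Real.exp ((x - 1 / 2) * (harmonic (M + 1) : ℝ) - (M + 1 : ℕ)) =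
        Real.exp ((x - 1 / 2) * harmonic M - M) *
          Real.exp ((x - 1 / 2) * ((M : ℝ) + 1)⁻¹ - 1) := by
      rw [← Real.exp_add, harmonic_succ]
      push_cast
      ring_nf
    have hratio := (div_eq_iff (barnesFactor_pos (by linarith) M).ne').1
      (barnesFactor_div_barnesFactor_sub_one x M)
    rw [Finset.prod_range_succ, Finset.prod_range_succ, Finset.prod_range_succ, ih, hratio, hexp,
      div_pow, add_comm x]
    push_cast
    field_simp
    ring

/-- Stirling's formula turns the telescoped product into Euler's limit for `Γ`. -/
theorem tendsto_prod_barnesFactor_ratio {x : ℝ} (hx : 0 < x) :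
    Tendsto (fun M : ℕ => (M + x) ^ M / (∏ j ∈ Finset.range M, (x + j)) *
        Real.exp ((x - 1 / 2) * harmonic M - M)) atTop
      (𝓝 (Real.Gamma x * Real.exp x * Real.exp ((x - 1 / 2) * Real.eulerMascheroniConstant) /
        √(2 * Real.pi))) := by
  have hone : Tendsto (fun M : ℕ => 1 + x / (M : ℝ)) atTop (𝓝 1) := by
    simpa using (tendsto_const_div_atTop_nhds_zero_nat x).const_add 1
  have hharm : Tendsto (fun M : ℕ => Real.exp ((x - 1 / 2) * ((harmonic M : ℝ) - Real.log M)))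
      atTop (𝓝 (Real.exp ((x - 1 / 2) * Real.eulerMascheroniConstant))) :=
    (Real.continuous_exp.tendsto _).comp (Real.tendsto_harmonic_sub_log.const_mul _)
  have hstirling : Tendsto (fun M : ℕ => √2 * Stirling.stirlingSeq M) atTop
      (𝓝 √(2 * Real.pi)) := by
    rw [Real.sqrt_mul zero_le_two]
    exact Stirling.tendsto_stirlingSeq_sqrt_pi.const_mul _
  have hlim := ((((Real.GammaSeq_tendsto_Gamma x).mul (Real.tendsto_one_add_div_pow_exp x)).mul
    hone).mul hharm).div hstirling (by positivity)
  rw [mul_one] at hlim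
  refine hlim.congr' ?_
  filter_upwards [eventually_gt_atTop 0] with M hM
  have hM' : (0 : ℝ) < M := by exact_mod_cast hM
  have hfact : (M.factorial : ℝ) ≠ 0 := by exact_mod_cast M.factorial_ne_zero
  have hpow : Real.exp ((x - 1 / 2) * ((harmonic M : ℝ) - Real.log M)) =
      Real.exp ((x - 1 / 2) * harmonic M) * √M / (M : ℝ) ^ x := by
    rw [Real.sqrt_eq_rpow, mul_div_assoc, ← Real.rpow_sub hM', Real.rpow_def_of_pos hM',
      ← Real.exp_add]
    ring_nf
  have hprod : ∏ j ∈ Finset.range M, (x + j) ≠ 0 :=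
    Finset.prod_ne_zero_iff.2 fun j _ => by positivity
  rw [Pi.div_apply, hpow, Real.GammaSeq, Stirling.stirlingSeq, Finset.prod_range_succ,
    Real.sqrt_mul zero_le_two, one_add_div hM'.ne', div_pow, div_pow, ← Real.exp_nat_mul, mul_one,
    Real.exp_sub, add_comm x (M : ℝ)]
  field_simp
  exact Real.sq_sqrt hM'.le

theorem barnesG_add_one {x : ℝ} (hx : 0 < x) : barnesG (x + 1) = Real.Gamma x * barnesG x := by
  have htprod := tendsto_nhds_unique
    (multipliable_barnesFactor (by linarith : -1 < x)).hasProd.tendsto_prod_nat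
    (((multipliable_barnesFactor (by linarith : -1 < x - 1)).hasProd.tendsto_prod_nat.mul
      (tendsto_prod_barnesFactor_ratio hx)).congr fun M => (prod_barnesFactor hx M).symm)
  have hrpow : (2 * Real.pi) ^ (x / 2) = (2 * Real.pi) ^ ((x - 1) / 2) * √(2 * Real.pi) := by
    rw [Real.sqrt_eq_rpow, ← Real.rpow_add (by positivity)]
    ring_nf
  have hexp : Real.exp (-((x - 1) + (1 + Real.eulerMascheroniConstant) * (x - 1) ^ 2) / 2) =
      Real.exp (-(x + (1 + Real.eulerMascheroniConstant) * x ^ 2) / 2) *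
        (Real.exp x * Real.exp ((x - 1 / 2) * Real.eulerMascheroniConstant)) := by
    rw [← Real.exp_add, ← Real.exp_add]
    ring_nf
  rw [barnesG_eq_tprod_barnesFactor, barnesG_eq_tprod_barnesFactor, add_sub_cancel_right, htprod,
    hrpow, hexp]
  field_simp

theorem barnesG_one : barnesG 1 = 1 := by
  simp [barnesG]

theorem barnesG_one_add_natCast (k : ℕ) :
    barnesG (1 + k) = ∏ j ∈ Finset.range k, (j.factorial : ℝ) := by
  induction k with
  | zero => simp [barnesG_one]
  | succ k ih =>
    rw [Nat.cast_succ, ← add_assoc, barnesG_add_one (by positivity), ih, Finset.prod_range_succ,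
      mul_comm, add_comm 1 (k : ℝ), Real.Gamma_nat_eq_factorial]

end BarnesG

section FinitePowers

variable {X : Type*} [MeasurableSpace X]

theorem measurable_fin_cons (n : ℕ) :
    Measurable (fun p : X × (Fin n → X) => (Fin.cons p.1 p.2 : Fin (n + 1) → X)) := by
  rw [measurable_pi_iff]
  refine Fin.cases ?_ fun j => ?_
  · simpa using measurable_fst
  · simpa using! (measurable_pi_apply j).comp measurable_snd

theorem lintegral_pi_fin_succ (μ : Measure X) [SigmaFinite μ] (n : ℕ)
    {f : (Fin (n + 1) → X) → ℝ≥0∞} (hf : Measurable f) :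
    ∫⁻ x, f x ∂(Measure.pi fun _ : Fin (n + 1) => μ) =
      ∫⁻ a, ∫⁻ b, f (Fin.cons a b) ∂(Measure.pi fun _ : Fin n => μ) ∂μ := by
  have h := (measurePreserving_piFinSuccAbove (fun _ : Fin (n + 1) => μ) 0).symm
  rw [← h.lintegral_comp hf]
  exact (lintegral_prod _ (hf.comp h.measurable).aemeasurable).trans <|
    lintegral_congr fun a => lintegral_congr fun b => congrArg f (Fin.insertNth_zero' a b)

theorem lintegral_pi_fin_prod_eq_prod (μ : Measure X) [SigmaFinite μ] {n : ℕ}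
    {f : Fin n → X → ℝ≥0∞} (hf : ∀ i, Measurable (f i)) :
    ∫⁻ x, ∏ i, f i (x i) ∂(Measure.pi fun _ : Fin n => μ) = ∏ i, ∫⁻ x, f i x ∂μ := by
  induction n with
  | zero => simp [Measure.pi_of_empty _ Fin.elim0]
  | succ n ih =>
    rw [lintegral_pi_fin_succ μ n (by fun_prop)]
    simp only [Fin.prod_univ_succ, Fin.cons_zero, Fin.cons_succ]
    have hprod : Measurable fun x : Fin n → X => ∏ i, f i.succ (x i) := by fun_prop
    simp_rw [lintegral_const_mul _ hprod, ih fun i => hf i.succ]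
    exact lintegral_mul_const _ (hf 0)

theorem pi_withDensity (μ : Measure X) [SigmaFinite μ] {d : X → ℝ≥0∞} (hd : Measurable d)
    [SigmaFinite (μ.withDensity d)] (n : ℕ) :
    Measure.pi (fun _ : Fin n => μ.withDensity d) =
      (Measure.pi fun _ : Fin n => μ).withDensity fun x => ∏ i, d (x i) := by
  refine Measure.pi_eq fun s hs => ?_
  have hind : ∀ x : Fin n → X, (Set.univ.pi s).indicator (fun x => ∏ i, d (x i)) x =
      ∏ i, (s i).indicator d (x i) := by
    intro x
    by_cases hx : x ∈ Set.univ.pi s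
    · rw [Set.indicator_of_mem hx]
      exact Finset.prod_congr rfl fun i _ => (Set.indicator_of_mem (hx i (Set.mem_univ i)) _).symm
    · obtain ⟨i, hi⟩ : ∃ i, x i ∉ s i := by simpa [Set.mem_pi] using hx
      rw [Set.indicator_of_notMem hx,
        Finset.prod_eq_zero (Finset.mem_univ i) (Set.indicator_of_notMem hi _)]
  rw [withDensity_apply _ (MeasurableSet.univ_pi hs),
    ← lintegral_indicator (MeasurableSet.univ_pi hs)]
  simp_rw [hind]
  rw [lintegral_pi_fin_prod_eq_prod μ fun i => hd.indicator (hs i)]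
  exact Finset.prod_congr rfl fun i _ => by
    rw [lintegral_indicator (hs i), withDensity_apply _ (hs i)]

end FinitePowers

section ComplexNormal

/-- The density `π⁻¹ exp (-‖w‖²)` of the standard complex normal law. -/
def complexNormalPDF (w : ℂ) : ℝ≥0∞ :=
  ENNReal.ofReal (Real.pi⁻¹ * Real.exp (-‖w‖ ^ 2))

@[fun_prop]
theorem measurable_complexNormalPDF : Measurable complexNormalPDF := by
  unfold complexNormalPDF; fun_prop

theorem complexNormalPDF_eq_gaussianPDF_mul (x y : ℝ) :
    complexNormalPDF (x + y * Complex.I) =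
      gaussianPDF 0 (1 / 2) x * gaussianPDF 0 (1 / 2) y := by
  rw [complexNormalPDF, gaussianPDF, gaussianPDF,
    ← ENNReal.ofReal_mul (gaussianPDFReal_nonneg _ _ _), gaussianPDFReal, gaussianPDFReal,
    Complex.sq_norm, Complex.normSq_add_mul_I]
  have hvar : 2 * Real.pi * ((1 / 2 : NNReal) : ℝ) = Real.pi := by push_cast; ring
  rw [hvar, mul_mul_mul_comm, ← mul_inv, Real.mul_self_sqrt Real.pi_pos.le, ← Real.exp_add]
  congr 3
  push_cast
  ring

theorem stdComplexNormal_eq_withDensity :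
    stdComplexNormal = volume.withDensity complexNormalPDF := by
  refine Measure.ext_of_lintegral _ fun f hf => ?_
  have hv : (1 / 2 : NNReal) ≠ 0 := by norm_num
  have hm : Measurable fun p : ℝ × ℝ => (p.1 : ℂ) + (p.2 : ℂ) * Complex.I := by fun_prop
  rw [stdComplexNormal, lintegral_map hf hm, gaussianReal_of_var_ne_zero _ hv,
    prod_withDensity (measurable_gaussianPDF _ _) (measurable_gaussianPDF _ _),
    lintegral_withDensity_eq_lintegral_mul _ (by fun_prop)
      (g := fun p : ℝ × ℝ => f ((p.1 : ℂ) + (p.2 : ℂ) * Complex.I)) (hf.comp hm),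
    lintegral_withDensity_eq_lintegral_mul _ measurable_complexNormalPDF hf,
    ← Complex.volume_preserving_equiv_real_prod.symm.lintegral_comp
      (measurable_complexNormalPDF.mul hf)]
  refine lintegral_congr fun p => ?_
  have hp : Complex.measurableEquivRealProd.symm p = (p.1 : ℂ) + (p.2 : ℂ) * Complex.I :=
    Complex.mk_eq_add_mul_I _ _
  rw [Pi.mul_apply, Pi.mul_apply, hp, complexNormalPDF_eq_gaussianPDF_mul]

theorem iidComplexNormal_eq_withDensity (N : ℕ) : iidComplexNormal N =
    volume.withDensity fun W : Fin N → Fin N → ℂ => ∏ i, ∏ j, complexNormalPDF (W i j) := by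
  have hprob : IsProbabilityMeasure (volume.withDensity complexNormalPDF) := by
    rw [← stdComplexNormal_eq_withDensity]; infer_instance
  have hrow : Measure.pi (fun _ : Fin N => stdComplexNormal) =
      volume.withDensity fun v : Fin N → ℂ => ∏ j, complexNormalPDF (v j) := by
    rw [stdComplexNormal_eq_withDensity, pi_withDensity _ measurable_complexNormalPDF,
      volume_pi]
  have hrow_prob : IsProbabilityMeasure
      (volume.withDensity fun v : Fin N → ℂ => ∏ j, complexNormalPDF (v j)) := by
    rw [← hrow]; infer_instance
  have hmeas : Measurable fun v : Fin N → ℂ => ∏ j, complexNormalPDF (v j) :=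
    Finset.measurable_prod _ fun j _ => measurable_complexNormalPDF.comp (measurable_pi_apply j)
  rw [iidComplexNormal, hrow, pi_withDensity _ hmeas]
  rfl

theorem integral_pow_mul_conj_pow_eq_zero {μ : Measure ℂ}
    (hμ : ∀ c : Circle, MeasurePreserving (fun w : ℂ => (c : ℂ) * w) μ μ) {p q : ℕ} (hpq : p ≠ q) :
    ∫ w, w ^ p * conj w ^ q ∂μ = 0 := by
  -- The rotation `c` is chosen so that it multiplies the integrand by `-1`.
  set c : Circle := Circle.exp (Real.pi / ((p : ℝ) - q)) with hc
  have hpq' : ((p : ℝ) - q : ℂ) ≠ 0 := by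
    rw [sub_ne_zero]; exact_mod_cast hpq
  have hcpq : (c : ℂ) ^ p * conj (c : ℂ) ^ q = -1 := by
    rw [hc, Circle.coe_exp, ← Complex.exp_conj, ← Complex.exp_nat_mul, ← Complex.exp_nat_mul,
      ← Complex.exp_add, ← Complex.exp_pi_mul_I]
    congr 1
    simp only [map_mul, Complex.conj_ofReal, Complex.conj_I]
    push_cast at hpq' ⊢
    field_simp
    ring
  have hneg : ∀ w : ℂ, (c * w : ℂ) ^ p * conj (c * w : ℂ) ^ q = -(w ^ p * conj w ^ q) := by
    intro w
    rw [map_mul, mul_pow, mul_pow, mul_mul_mul_comm, hcpq, neg_one_mul]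
  have hrot := (hμ c).integral_comp (measurableEmbedding_mulLeft₀ c.coe_ne_zero)
    fun w => w ^ p * conj w ^ q
  simp_rw [hneg, integral_neg] at hrot
  exact self_eq_neg.1 hrot.symm

theorem measurePreserving_circle_mul_stdComplexNormal (c : Circle) :
    MeasurePreserving (fun w : ℂ => (c : ℂ) * w) stdComplexNormal stdComplexNormal := by
  have hmeas : Measurable fun w : ℂ => (c : ℂ) * w := measurable_const_mul _
  have hvol : MeasurePreserving (fun w : ℂ => (c : ℂ) * w) := (rotation c).measurePreserving
  refine ⟨hmeas, Measure.ext_of_lintegral _ fun f hf => ?_⟩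
  rw [lintegral_map hf hmeas, stdComplexNormal_eq_withDensity,
    lintegral_withDensity_eq_lintegral_mul _ measurable_complexNormalPDF
      (g := fun w => f (c * w)) (hf.comp hmeas),
    lintegral_withDensity_eq_lintegral_mul _ measurable_complexNormalPDF hf,
    ← hvol.lintegral_comp (measurable_complexNormalPDF.mul hf)]
  simp only [Pi.mul_apply, complexNormalPDF, norm_mul, Circle.norm_coe, one_mul]

theorem integral_stdComplexNormal (f : ℂ → ℂ) :
    ∫ w, f w ∂stdComplexNormal = (Real.pi : ℂ)⁻¹ * ∫ w, Real.exp (-‖w‖ ^ 2) * f w := by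
  rw [stdComplexNormal_eq_withDensity, integral_withDensity_eq_integral_toReal_smul
    measurable_complexNormalPDF (by simp [complexNormalPDF]), ← integral_const_mul]
  refine integral_congr_ae (ae_of_all _ fun w => ?_)
  simp only [complexNormalPDF, ENNReal.toReal_ofReal (by positivity :
    0 ≤ Real.pi⁻¹ * Real.exp (-‖w‖ ^ 2)), Complex.real_smul]
  push_cast
  ring

theorem integrable_stdComplexNormal_iff {f : ℂ → ℂ} :
    Integrable f stdComplexNormal ↔ Integrable fun w => (Real.exp (-‖w‖ ^ 2) : ℂ) * f w := by
  rw [stdComplexNormal_eq_withDensity, integrable_withDensity_iff_integrable_smul'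
    measurable_complexNormalPDF (by simp [complexNormalPDF]),
    ← integrable_const_mul_iff (c := (Real.pi : ℂ)⁻¹) (by simp [Real.pi_ne_zero])
      fun w => (Real.exp (-‖w‖ ^ 2) : ℂ) * f w]
  refine integrable_congr (ae_of_all _ fun w => ?_)
  simp only [complexNormalPDF, ENNReal.toReal_ofReal (by positivity :
    0 ≤ Real.pi⁻¹ * Real.exp (-‖w‖ ^ 2)), Complex.real_smul]
  push_cast
  ring

theorem integral_norm_pow_mul_exp_neg_sq (p : ℕ) :
    ∫ w : ℂ, ‖w‖ ^ p * Real.exp (-‖w‖ ^ 2) = Real.pi * Real.Gamma (p / 2 + 1) := by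
  have h := Complex.integral_rpow_mul_exp_neg_rpow (p := 2) (q := p) (by norm_num)
    (by linarith [p.cast_nonneg (α := ℝ)])
  simp only [Real.rpow_natCast, Real.rpow_ofNat] at h
  rw [h, add_div, div_self two_ne_zero, mul_div_assoc, mul_comm (2 : ℝ),
    div_mul_cancel_of_invertible]

theorem integrable_norm_pow_mul_exp_neg_sq (p : ℕ) :
    Integrable fun w : ℂ => ‖w‖ ^ p * Real.exp (-‖w‖ ^ 2) := by
  refine not_imp_comm.1 integral_undef ?_
  rw [integral_norm_pow_mul_exp_neg_sq]
  exact (mul_pos Real.pi_pos (Real.Gamma_pos_of_pos (by positivity))).ne'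

theorem integrable_pow_mul_conj_pow_stdComplexNormal (p q : ℕ) :
    Integrable (fun w : ℂ => w ^ p * conj w ^ q) stdComplexNormal := by
  rw [integrable_stdComplexNormal_iff]
  refine (integrable_norm_pow_mul_exp_neg_sq (p + q)).mono' (by fun_prop)
    (ae_of_all _ fun w => le_of_eq ?_)
  rw [norm_mul, norm_mul, norm_pow, norm_pow, RCLike.norm_conj, ← pow_add, Complex.norm_real,
    Real.norm_of_nonneg (by positivity), mul_comm]

theorem integral_pow_mul_conj_pow_stdComplexNormal (p q : ℕ) :
    ∫ w : ℂ, w ^ p * conj w ^ q ∂stdComplexNormal = if p = q then (p.factorial : ℂ) else 0 := by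
  split_ifs with h
  · have hnorm : ∀ w : ℂ, (Real.exp (-‖w‖ ^ 2) : ℂ) * (w ^ p * conj w ^ p) =
        ((‖w‖ ^ (2 * p) * Real.exp (-‖w‖ ^ 2) : ℝ) : ℂ) := by
      intro w
      rw [← mul_pow, Complex.mul_conj, Complex.normSq_eq_norm_sq]
      push_cast
      rw [pow_mul, mul_comm]
    rw [← h, integral_stdComplexNormal]
    simp_rw [hnorm]
    rw [integral_complex_ofReal, integral_norm_pow_mul_exp_neg_sq, Nat.cast_mul, Nat.cast_ofNat,
      mul_div_cancel_left₀ _ (two_ne_zero' ℝ), Real.Gamma_nat_eq_factorial]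
    push_cast
    exact inv_mul_cancel_left₀ (by exact_mod_cast Real.pi_ne_zero) _
  · exact integral_pow_mul_conj_pow_eq_zero measurePreserving_circle_mul_stdComplexNormal h

end ComplexNormal

section DetFunctional

open MvPolynomial

variable {n R : Type*} [Fintype n] [CommRing R]

theorem coeff_sum_C_mul_X_pow {σ S : Type*} [Fintype σ] [CommSemiring S] (a : σ → S)
    {e : σ →₀ ℕ} (he : ∀ i, e i ≤ 1) :
    coeff e ((∑ i, C (a i) * X i) ^ ∑ i, e i) = (∑ i, e i).factorial * ∏ i, a i ^ e i := by
  classical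
  have hterm : ∀ k : σ → ℕ, (Nat.multinomial Finset.univ k : MvPolynomial σ S) *
      ∏ i, (C (a i) * X i) ^ k i =
        monomial (Finsupp.equivFunOnFinite.symm k)
          (Nat.multinomial Finset.univ k * ∏ i, a i ^ k i) := by
    intro k
    simp_rw [mul_pow, Finset.prod_mul_distrib]
    rw [monomial_eq, Finsupp.prod_fintype _ _ (by simp)]
    simp [mul_assoc]
  have hfactorial : ∏ i, (e i).factorial = 1 :=
    Finset.prod_eq_one fun i _ => Nat.factorial_eq_one.2 (he i)
  rw [Finset.sum_pow_eq_sum_piAntidiag, coeff_sum]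
  simp_rw [hterm, coeff_monomial]
  rw [Finset.sum_eq_single (e : σ → ℕ)]
  · rw [if_pos (by ext; simp), Nat.multinomial, hfactorial, Nat.div_one]
  · rintro k - hk
    exact if_neg fun h => hk (by simp [← h])
  · exact fun h => absurd (by simp [Finset.mem_piAntidiag]) h

/-- The linear form `∑ A x y • X (x, y)` in one commuting variable per matrix entry. -/
def entryForm : Matrix n n R →ₗ[R] MvPolynomial (n × n) R :=
  ∑ p : n × n, (LinearMap.toSpanSingleton R _ (X p)).comp (Matrix.entryLinearMap R R p.1 p.2)

theorem entryForm_apply (A : Matrix n n R) :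
    entryForm A = ∑ p : n × n, C (A p.1 p.2) * X p := by
  simp [entryForm, smul_eq_C_mul]

variable [DecidableEq n]

theorem entryForm_single (x y : n) : entryForm (Matrix.single x y (1 : R)) = X (x, y) := by
  rw [entryForm_apply, Finset.sum_eq_single (x, y)]
  · simp
  · rintro ⟨a, b⟩ - h
    rw [Matrix.single_apply_of_ne (h := fun hab => h (Prod.ext hab.1.symm hab.2.symm)), map_zero,
      zero_mul]
  · simp

/-- The exponent of the monomial `∏ x, X (x, π x)`. -/
def permExponent (π : Equiv.Perm n) : n × n →₀ ℕ :=
  Finsupp.equivFunOnFinite.symm fun p => if π p.1 = p.2 then 1 else 0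

theorem permExponent_apply (π : Equiv.Perm n) (p : n × n) :
    permExponent π p = if π p.1 = p.2 then 1 else 0 := rfl

theorem sum_permExponent_row (π : Equiv.Perm n) (x : n) : ∑ y, permExponent π (x, y) = 1 := by
  simp [permExponent_apply]

theorem permExponent_mul_swap (π : Equiv.Perm n) {x x' : n} (hx : x ≠ x') :
    permExponent (π * Equiv.swap x x') + Finsupp.single (x, π x) 1 + Finsupp.single (x', π x') 1 =
      permExponent π + Finsupp.single (x, π x') 1 + Finsupp.single (x', π x) 1 := by
  ext ⟨a, b⟩
  simp only [Finsupp.add_apply, permExponent_apply, Finsupp.single_apply, Equiv.Perm.mul_apply,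
    Prod.mk.injEq]
  rcases eq_or_ne a x with rfl | h
  · simp only [Equiv.swap_apply_left, true_and, hx.symm, false_and, if_false]
    ring
  · rcases eq_or_ne a x' with rfl | h'
    · simp only [Equiv.swap_apply_right, true_and, hx, false_and, if_false]
      ring
    · simp [Equiv.swap_apply_of_ne_of_ne h h', h.symm, h'.symm]

theorem single_add_single_add_eq_permExponent_swap {π : Equiv.Perm n} {x x' y y' : n}
    (hx : x ≠ x') {β : n × n →₀ ℕ}
    (h : Finsupp.single (x, y) 1 + Finsupp.single (x', y') 1 + β = permExponent π) :
    Finsupp.single (x, y') 1 + Finsupp.single (x', y) 1 + β =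
      permExponent (π * Equiv.swap x x') := by
  have hπx : π x = y := by
    by_contra hne
    have := DFunLike.congr_fun h (x, y)
    simp [permExponent_apply, hne] at this
  have hπx' : π x' = y' := by
    by_contra hne
    have := DFunLike.congr_fun h (x', y')
    simp [permExponent_apply, hne] at this
  have hswap := permExponent_mul_swap π hx
  rw [hπx, hπx', ← h] at hswap
  refine add_right_cancel (b := Finsupp.single (x, y) 1 + Finsupp.single (x', y') 1) ?_
  rw [← add_assoc (permExponent _), hswap]
  abel

theorem single_add_single_add_ne_permExponent (x y y' : n) (β : n × n →₀ ℕ) (π : Equiv.Perm n) :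
    Finsupp.single (x, y) 1 + Finsupp.single (x, y') 1 + β ≠ permExponent π := by
  intro h
  have hrow := sum_permExponent_row π x
  rw [← h] at hrow
  simp [Finset.sum_add_distrib, Finsupp.single_apply] at hrow
  lia

/-- The linear functional on polynomials in the entries of a matrix which takes the signed sum of
the coefficients of the monomials occurring in the determinant. -/
def detFunctional (n R : Type*) [Fintype n] [DecidableEq n] [CommRing R] :
    MvPolynomial (n × n) R →ₗ[R] R :=
  ∑ π : Equiv.Perm n, ((Equiv.Perm.sign π : ℤ) : R) • lcoeff R (permExponent π)

theorem detFunctional_apply (s : MvPolynomial (n × n) R) :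
    detFunctional n R s =
      ∑ π : Equiv.Perm n, ((Equiv.Perm.sign π : ℤ) : R) * coeff (permExponent π) s := by
  simp [detFunctional]

theorem detFunctional_entryForm_pow (A : Matrix n n R) :
    detFunctional n R (entryForm A ^ Fintype.card n) = (Fintype.card n).factorial * A.det := by
  rw [detFunctional_apply, ← Matrix.det_transpose, Matrix.det_apply', Finset.mul_sum]
  refine Finset.sum_congr rfl fun π _ => ?_
  have hcard : Fintype.card n = ∑ p, permExponent π p := by
    simp [Fintype.sum_prod_type, sum_permExponent_row]
  have hle : ∀ p, permExponent π p ≤ 1 := fun p => by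
    rw [permExponent_apply]; split_ifs <;> simp
  rw [entryForm_apply, hcard, coeff_sum_C_mul_X_pow (fun p : n × n => A p.1 p.2) hle,
    Fintype.prod_prod_type]
  simp only [permExponent_apply, pow_ite, pow_one, pow_zero, Finset.prod_ite_eq, Finset.mem_univ,
    if_true, Matrix.transpose_apply]
  ring

theorem X_mul_X_mul_monomial {σ S : Type*} [CommSemiring S] (p q : σ) (β : σ →₀ ℕ) (b : S) :
    X p * X q * monomial β b = monomial (Finsupp.single p 1 + Finsupp.single q 1 + β) b := by
  rw [X, X, monomial_mul, monomial_mul, one_mul, one_mul]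

theorem detFunctional_X_mul_X_add_X_mul_X_mul (x x' y y' : n) (t : MvPolynomial (n × n) R) :
    detFunctional n R ((X (x, y) * X (x', y') + X (x, y') * X (x', y)) * t) = 0 := by
  induction t using MvPolynomial.induction_on' with
  | add p q hp hq => rw [mul_add, map_add, hp, hq, add_zero]
  | monomial β b =>
    rw [add_mul, map_add, X_mul_X_mul_monomial, X_mul_X_mul_monomial, detFunctional_apply,
      detFunctional_apply]
    simp_rw [coeff_monomial]
    rcases eq_or_ne x x' with rfl | hx
    · simp [single_add_single_add_ne_permExponent]
    -- Composition with the transposition of `x` and `x'` matches the two sums, with opposite signs.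
    · rw [← Equiv.sum_comp (Equiv.mulRight (Equiv.swap x x')), ← Finset.sum_add_distrib]
      refine Finset.sum_eq_zero fun π _ => ?_
      have hiff : Finsupp.single (x, y) 1 + Finsupp.single (x', y') 1 + β =
            permExponent (π * Equiv.swap x x') ↔
          Finsupp.single (x, y') 1 + Finsupp.single (x', y) 1 + β = permExponent π := by
        refine ⟨fun h => ?_, single_add_single_add_eq_permExponent_swap hx⟩
        have := single_add_single_add_eq_permExponent_swap hx h
        rwa [mul_assoc, Equiv.swap_mul_self, mul_one] at this
      rw [Equiv.coe_mulRight, Equiv.Perm.sign_mul, Equiv.Perm.sign_swap hx]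
      simp only [hiff]
      split_ifs <;> simp

/-- The largest ideal contained in the kernel of `detFunctional`: working modulo this ideal is
working with anticommuting rows and columns. -/
def detIdeal (n R : Type*) [Fintype n] [DecidableEq n] [CommRing R] :
    Ideal (MvPolynomial (n × n) R) where
  carrier := {s | ∀ t, detFunctional n R (s * t) = 0}
  add_mem' := fun {a b} ha hb t => by rw [add_mul, map_add, ha t, hb t, add_zero]
  zero_mem' := fun t => by simp
  smul_mem' := fun c s hs t => by
    rw [smul_eq_mul, mul_comm c s, mul_assoc]; exact hs _

theorem detFunctional_eq_of_sub_mem {s t : MvPolynomial (n × n) R} (h : s - t ∈ detIdeal n R) :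
    detFunctional n R s = detFunctional n R t := by
  have := h 1
  rwa [mul_one, map_sub, sub_eq_zero] at this

theorem X_mul_X_add_X_mul_X_mem_detIdeal (x x' y y' : n) :
    (X (x, y) * X (x', y') + X (x, y') * X (x', y) : MvPolynomial (n × n) R) ∈ detIdeal n R :=
  detFunctional_X_mul_X_add_X_mul_X_mul x x' y y'

end DetFunctional

section GaussFunctional

open MvPolynomial

variable {ι : Type*} [Fintype ι]

/-- The moment `𝔼 w ^ a * conj w ^ b` of a standard complex normal variable `w`. -/
def complexMoment (a b : ℕ) : ℕ :=
  if a = b then a.factorial else 0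

theorem complexMoment_comm (a b : ℕ) : complexMoment a b = complexMoment b a := by
  unfold complexMoment
  split_ifs <;> simp_all

theorem complexMoment_succ_left (a b : ℕ) :
    complexMoment (1 + a) b = b * complexMoment a (b - 1) := by
  rcases b with _ | b
  · simp [complexMoment]
  · rw [add_comm, Nat.add_sub_cancel]
    by_cases h : a = b <;> simp [complexMoment, h, Nat.factorial_succ]

theorem complexMoment_succ_right (a b : ℕ) :
    complexMoment a (1 + b) = a * complexMoment (a - 1) b := by
  rw [complexMoment_comm, complexMoment_succ_left, complexMoment_comm]

/-- The moment of exponent `α` of independent standard complex normal variables, indexed by the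
left summand, and of their conjugates, indexed by the right summand. -/
def gaussMoment (α : ι ⊕ ι →₀ ℕ) : ℕ :=
  ∏ i, complexMoment (α (Sum.inl i)) (α (Sum.inr i))

theorem gaussMoment_single_add (s : ι ⊕ ι) (α : ι ⊕ ι →₀ ℕ) :
    gaussMoment (Finsupp.single s 1 + α) =
      α s.swap * gaussMoment (α - Finsupp.single s.swap 1) := by
  classical
  unfold gaussMoment
  rcases s with i | i
  all_goals
    rw [← Finset.mul_prod_erase _ _ (Finset.mem_univ i),
      ← Finset.mul_prod_erase (Finset.univ : Finset ι) _ (Finset.mem_univ i), ← mul_assoc]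
    congr 1
    · simp [complexMoment_succ_left, complexMoment_succ_right]
    · refine Finset.prod_congr rfl fun j hj => ?_
      have hne : i ≠ j := (Finset.ne_of_mem_erase hj).symm
      simp [hne]

/-- The algebraic expectation of a polynomial in independent standard complex normal variables and
their conjugates. -/
def gaussFunctional (ι B : Type*) [Fintype ι] [CommSemiring B] : MvPolynomial (ι ⊕ ι) B →ₗ[B] B :=
  (basisMonomials (ι ⊕ ι) B).constr B fun α => (gaussMoment α : B)

variable {B : Type*} [CommSemiring B]

theorem gaussFunctional_monomial (α : ι ⊕ ι →₀ ℕ) (b : B) :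
    gaussFunctional ι B (monomial α b) = b * gaussMoment α := by
  have h : monomial α b = b • basisMonomials (ι ⊕ ι) B α := by
    rw [coe_basisMonomials, smul_monomial, smul_eq_mul, mul_one]
  rw [h, map_smul, gaussFunctional, Module.Basis.constr_basis, smul_eq_mul]

theorem gaussFunctional_one : gaussFunctional ι B 1 = 1 := by
  rw [← C_1, C_apply, gaussFunctional_monomial]
  simp [gaussMoment, complexMoment]

theorem gaussFunctional_C_mul (b : B) (Y : MvPolynomial (ι ⊕ ι) B) :
    gaussFunctional ι B (C b * Y) = b * gaussFunctional ι B Y := by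
  rw [← smul_eq_C_mul, map_smul, smul_eq_mul]

theorem gaussFunctional_X_mul (s : ι ⊕ ι) (Y : MvPolynomial (ι ⊕ ι) B) :
    gaussFunctional ι B (X s * Y) = gaussFunctional ι B (pderiv s.swap Y) := by
  induction Y using MvPolynomial.induction_on' with
  | add p q hp hq => rw [mul_add, map_add, map_add, map_add, hp, hq]
  | monomial α b =>
    rw [X, monomial_mul, one_mul, pderiv_monomial, gaussFunctional_monomial,
      gaussFunctional_monomial, gaussMoment_single_add]
    push_cast
    ring

/-- The moment of order `r` of a Gaussian variable of mean `m` and variance `Q`, as a polynomial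
in `m` and `Q`. -/
def wickPoly (m Q : B) : ℕ → B
  | 0 => 1
  | 1 => m
  | r + 2 => m * wickPoly m Q (r + 1) + (r + 1 : ℕ) * Q * wickPoly m Q r

/-- The affine form with constant term `m` and coefficients `c` in complex normal variables and
their conjugates. -/
def gaussForm (m : B) (c : ι ⊕ ι → B) : MvPolynomial (ι ⊕ ι) B :=
  C m + ∑ s, C (c s) * X s

theorem pderiv_gaussForm (m : B) (c : ι ⊕ ι → B) (s : ι ⊕ ι) :
    pderiv s (gaussForm m c) = C (c s) := by
  classical
  simp [gaussForm, pderiv_X, Pi.single_apply, -Fintype.sum_sum_type]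

theorem gaussFunctional_gaussForm_pow_succ (m : B) (c : ι ⊕ ι → B) (r : ℕ) :
    gaussFunctional ι B (gaussForm m c ^ (r + 1)) =
      m * gaussFunctional ι B (gaussForm m c ^ r) +
        r * (∑ s, c s * c s.swap) * gaussFunctional ι B (gaussForm m c ^ (r - 1)) := by
  have hexpand : gaussForm m c ^ (r + 1) =
      C m * gaussForm m c ^ r + ∑ s, C (c s) * (X s * gaussForm m c ^ r) := by
    rw [pow_succ']
    nth_rewrite 1 [gaussForm]
    rw [add_mul, Finset.sum_mul]
    simp_rw [mul_assoc]
  have hderiv : ∀ s, pderiv s (gaussForm m c ^ r) = C (r * c s) * gaussForm m c ^ (r - 1) := by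
    intro s
    rw [pderiv_pow, pderiv_gaussForm, map_mul, map_natCast]
    ring
  rw [hexpand, map_add, map_sum, gaussFunctional_C_mul, Finset.mul_sum, Finset.sum_mul]
  congr 1
  refine Finset.sum_congr rfl fun s _ => ?_
  rw [gaussFunctional_C_mul, gaussFunctional_X_mul, hderiv, gaussFunctional_C_mul]
  ring

theorem gaussFunctional_gaussForm_pow (m : B) (c : ι ⊕ ι → B) (r : ℕ) :
    gaussFunctional ι B (gaussForm m c ^ r) = wickPoly m (∑ s, c s * c s.swap) r := by
  induction r using Nat.twoStepInduction with
  | zero => rw [pow_zero, gaussFunctional_one, wickPoly]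
  | one =>
    rw [gaussFunctional_gaussForm_pow_succ, pow_zero, gaussFunctional_one]
    simp [wickPoly]
  | more r ih₀ ih₁ =>
    rw [gaussFunctional_gaussForm_pow_succ, ih₁, Nat.add_sub_cancel, ih₀, wickPoly]

theorem wickPoly_sub_wickPoly_mem {A : Type*} [CommRing A] (I : Ideal A) (m : A) {Q Q' : A}
    (h : Q - Q' ∈ I) (r : ℕ) : wickPoly m Q r - wickPoly m Q' r ∈ I := by
  rw [← Ideal.Quotient.mk_eq_mk_iff_sub_mem] at h
  induction r using Nat.twoStepInduction with
  | zero => simp [wickPoly]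
  | one => simp [wickPoly]
  | more r ih₀ ih₁ =>
    rw [← Ideal.Quotient.mk_eq_mk_iff_sub_mem] at ih₀ ih₁ ⊢
    simp only [wickPoly, map_add, map_mul, ih₀, ih₁, h]

end GaussFunctional

section GaussianVectors

variable {ι Ω : Type*}

/-- The coordinates of a complex vector, followed by their conjugates. -/
def withConj (g : ι → ℂ) : ι ⊕ ι → ℂ :=
  Sum.elim g fun i => conj (g i)

variable [Fintype ι] [MeasurableSpace Ω]

/-- The mixed moments of the random vector `g` and of its conjugate exist, and are those of a
vector of independent standard complex normal variables. -/
structure HasComplexGaussianMoments (μ : Measure Ω) (g : Ω → ι → ℂ) : Prop where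
  integrable (α : ι ⊕ ι →₀ ℕ) : Integrable (fun ω => ∏ s, withConj (g ω) s ^ α s) μ
  integral_eq (α : ι ⊕ ι →₀ ℕ) : ∫ ω, ∏ s, withConj (g ω) s ^ α s ∂μ = gaussMoment α

theorem hasComplexGaussianMoments_iidComplexNormal (N : ℕ) :
    HasComplexGaussianMoments (iidComplexNormal N) Function.uncurry := by
  have hprod : ∀ (α : (Fin N × Fin N) ⊕ (Fin N × Fin N) →₀ ℕ) (W : Fin N → Fin N → ℂ),
      ∏ s, withConj (Function.uncurry W) s ^ α s =
        ∏ i, ∏ j, (W i j ^ α (Sum.inl (i, j)) * conj (W i j) ^ α (Sum.inr (i, j))) := by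
    intro α W
    rw [Fintype.prod_sum_type, ← Finset.prod_mul_distrib, Fintype.prod_prod_type]
    rfl
  refine ⟨fun α => ?_, fun α => ?_⟩ <;> simp_rw [hprod]
  · refine Integrable.fintype_prod_dep (f := fun i (v : Fin N → ℂ) =>
      ∏ j, (v j ^ α (Sum.inl (i, j)) * conj (v j) ^ α (Sum.inr (i, j)))) fun i => ?_
    exact Integrable.fintype_prod_dep
      (f := fun j (w : ℂ) => w ^ α (Sum.inl (i, j)) * conj w ^ α (Sum.inr (i, j)))
      fun j => integrable_pow_mul_conj_pow_stdComplexNormal _ _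
  · rw [iidComplexNormal, integral_fintype_prod_eq_prod (f := fun i (v : Fin N → ℂ) =>
        ∏ j, (v j ^ α (Sum.inl (i, j)) * conj (v j) ^ α (Sum.inr (i, j)))),
      gaussMoment, Fintype.prod_prod_type, Nat.cast_prod]
    refine Finset.prod_congr rfl fun i _ => ?_
    rw [integral_fintype_prod_eq_prod
      (f := fun j (w : ℂ) => w ^ α (Sum.inl (i, j)) * conj w ^ α (Sum.inr (i, j))), Nat.cast_prod]
    refine Finset.prod_congr rfl fun j _ => ?_
    rw [integral_pow_mul_conj_pow_stdComplexNormal, complexMoment]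
    push_cast
    rfl

namespace HasComplexGaussianMoments

variable {μ : Measure Ω} {g : Ω → ι → ℂ} {B : Type*} [CommRing B] [Algebra ℂ B]

theorem integrable_and_integral_eval (hg : HasComplexGaussianMoments μ g) (l : B →ₗ[ℂ] ℂ)
    (Y : MvPolynomial (ι ⊕ ι) B) :
    Integrable (fun ω => l (MvPolynomial.eval (fun s => algebraMap ℂ B (withConj (g ω) s)) Y)) μ ∧
      ∫ ω, l (MvPolynomial.eval (fun s => algebraMap ℂ B (withConj (g ω) s)) Y) ∂μ =
        l (gaussFunctional ι B Y) := by
  induction Y using MvPolynomial.induction_on' with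
  | add p q hp hq =>
    simp only [map_add]
    refine ⟨hp.1.add hq.1, ?_⟩
    rw [integral_add hp.1 hq.1, hp.2, hq.2]
  | monomial α b =>
    have hmonomial : ∀ ω, l (MvPolynomial.eval (fun s => algebraMap ℂ B (withConj (g ω) s))
        (MvPolynomial.monomial α b)) = l b * ∏ s, withConj (g ω) s ^ α s := by
      intro ω
      rw [MvPolynomial.eval_monomial, Finsupp.prod_fintype _ _ (by simp)]
      simp_rw [← map_pow, ← map_prod]
      rw [mul_comm, ← Algebra.smul_def, map_smul, smul_eq_mul, mul_comm]
    simp_rw [hmonomial]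
    refine ⟨(hg.integrable α).const_mul _, ?_⟩
    rw [integral_const_mul, hg.integral_eq, gaussFunctional_monomial,
      ← map_natCast (algebraMap ℂ B), mul_comm b, ← Algebra.smul_def, map_smul, smul_eq_mul,
      mul_comm]

end HasComplexGaussianMoments

/-- The matrix-valued affine form with mean `M` and coefficients `U` in the vector `g` and its
conjugate. -/
def affineMatrix {n : Type*} (M : Matrix n n ℂ) (U : ι ⊕ ι → Matrix n n ℂ) (g : ι → ℂ) :
    Matrix n n ℂ :=
  M + ∑ s, withConj g s • U s

/-- The covariance of the entries of `affineMatrix M U g` for a complex normal vector `g`, as a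
quadratic form. -/
def covarianceForm {n : Type*} [Fintype n] (U : ι ⊕ ι → Matrix n n ℂ) : MvPolynomial (n × n) ℂ :=
  ∑ s, entryForm (U s) * entryForm (U s.swap)

variable {n : Type*} [Fintype n] [DecidableEq n] {μ : Measure Ω} {g : Ω → ι → ℂ}

theorem factorial_mul_integral_det_affineMatrix (hg : HasComplexGaussianMoments μ g)
    (M : Matrix n n ℂ) (U : ι ⊕ ι → Matrix n n ℂ) :
    (Fintype.card n).factorial * ∫ ω, (affineMatrix M U (g ω)).det ∂μ =
      detFunctional n ℂ (wickPoly (entryForm M) (covarianceForm U) (Fintype.card n)) := by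
  rw [covarianceForm, ← gaussFunctional_gaussForm_pow _ fun s => entryForm (U s),
    ← (hg.integrable_and_integral_eval _ _).2, ← integral_const_mul]
  refine integral_congr_ae (ae_of_all _ fun ω => ?_)
  simp only [map_pow]
  rw [← detFunctional_entryForm_pow]
  congr 2
  simp [affineMatrix, gaussForm, MvPolynomial.smul_eq_C_mul, MvPolynomial.algebraMap_eq, mul_comm,
    -Fintype.sum_sum_type]

theorem integral_det_affineMatrix_eq (hg : HasComplexGaussianMoments μ g)
    {κ Ω' : Type*} [Fintype κ] [MeasurableSpace Ω'] {ν : Measure Ω'} {h : Ω' → κ → ℂ}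
    (hh : HasComplexGaussianMoments ν h) (M : Matrix n n ℂ) {U : ι ⊕ ι → Matrix n n ℂ}
    {V : κ ⊕ κ → Matrix n n ℂ} (hUV : covarianceForm U - covarianceForm V ∈ detIdeal n ℂ) :
    ∫ ω, (affineMatrix M U (g ω)).det ∂μ = ∫ ω, (affineMatrix M V (h ω)).det ∂ν := by
  refine mul_left_cancel₀ (Nat.cast_ne_zero.2 (Fintype.card n).factorial_ne_zero) ?_
  rw [factorial_mul_integral_det_affineMatrix hg, factorial_mul_integral_det_affineMatrix hh]
  exact detFunctional_eq_of_sub_mem (wickPoly_sub_wickPoly_mem _ _ hUV _)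

end GaussianVectors

section Duality

variable {N k : ℕ}

/-- The index type of the block matrices in the duality formula. -/
abbrev DualIndex (N k : ℕ) : Type := Fin N × (Fin k ⊕ Fin k)

/-- The block matrix `diag (-z, -conj z)`. -/
def dualMean (N k : ℕ) (z : ℂ) : Matrix (DualIndex N k) (DualIndex N k) ℂ :=
  Matrix.diagonal fun x => Sum.elim (fun _ => -z) (fun _ => -conj z) x.2

/-- The coefficients of `diag (c G, c Gᴴ)`, with `k` copies of each block, in the entries of the
`N × N` matrix `G` and their conjugates. -/
def diagCoeff (N k : ℕ) (c : ℂ) :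
    (Fin N × Fin N) ⊕ (Fin N × Fin N) → Matrix (DualIndex N k) (DualIndex N k) ℂ :=
  Sum.elim (fun p => c • ∑ a : Fin k, Matrix.single (p.1, Sum.inl a) (p.2, Sum.inl a) 1)
    fun p => c • ∑ b : Fin k, Matrix.single (p.2, Sum.inr b) (p.1, Sum.inr b) 1

/-- The coefficients of `N` copies of `!![0, c W; -c Wᴴ, 0]` in the entries of the `k × k` matrix
`W` and their conjugates. -/
def antidiagCoeff (N k : ℕ) (c : ℂ) :
    (Fin k × Fin k) ⊕ (Fin k × Fin k) → Matrix (DualIndex N k) (DualIndex N k) ℂ :=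
  Sum.elim (fun q => c • ∑ i : Fin N, Matrix.single (i, Sum.inl q.1) (i, Sum.inr q.2) 1)
    fun q => (-c) • ∑ j : Fin N, Matrix.single (j, Sum.inr q.2) (j, Sum.inl q.1) 1

theorem sum_mul_sum_add_sum_mul_sum {R α β : Type*} [NonUnitalNonAssocSemiring R] [Fintype α]
    [Fintype β] (A B : α → β × β → R) (C D : β → α × α → R) :
    (∑ p, (∑ a, A a p) * ∑ b, B b p) + ∑ q, (∑ i, C i q) * ∑ j, D j q =
      ∑ p : β × β, ∑ q : α × α, (A q.1 p * B q.2 p + C p.1 q * D p.2 q) := by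
  simp only [Finset.sum_add_distrib, Finset.sum_mul_sum]
  congr 1
  · exact Finset.sum_congr rfl fun p _ =>
      (Fintype.sum_prod_type fun q : α × α => A q.1 p * B q.2 p).symm
  · rw [Finset.sum_comm (f := fun (p : β × β) (q : α × α) => C p.1 q * D p.2 q)]
    exact Finset.sum_congr rfl fun q _ =>
      (Fintype.sum_prod_type fun p : β × β => C p.1 q * D p.2 q).symm

theorem covarianceForm_diagCoeff_sub_antidiagCoeff_mem (c : ℂ) :
    covarianceForm (diagCoeff N k c) - covarianceForm (antidiagCoeff N k c) ∈
      detIdeal (DualIndex N k) ℂ := by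
  have hdiff : covarianceForm (diagCoeff N k c) - covarianceForm (antidiagCoeff N k c) =
      MvPolynomial.C (2 * c ^ 2) * ∑ p : Fin N × Fin N, ∑ q : Fin k × Fin k,
        (MvPolynomial.X ((p.1, Sum.inl q.1), (p.2, Sum.inl q.1)) *
            MvPolynomial.X ((p.2, Sum.inr q.2), (p.1, Sum.inr q.2)) +
          MvPolynomial.X ((p.1, Sum.inl q.1), (p.1, Sum.inr q.2)) *
            MvPolynomial.X ((p.2, Sum.inr q.2), (p.2, Sum.inl q.1))) := by
    rw [← sum_mul_sum_add_sum_mul_sum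
      (fun (a : Fin k) (p : Fin N × Fin N) => MvPolynomial.X ((p.1, Sum.inl a), (p.2, Sum.inl a)))
      (fun b p => MvPolynomial.X ((p.2, Sum.inr b), (p.1, Sum.inr b)))
      (fun i q => MvPolynomial.X ((i, Sum.inl q.1), (i, Sum.inr q.2)))
      (fun j q => MvPolynomial.X ((j, Sum.inr q.2), (j, Sum.inl q.1)))]
    simp only [covarianceForm, diagCoeff, antidiagCoeff, Fintype.sum_sum_type, Sum.elim_inl,
      Sum.elim_inr, Sum.swap_inl, Sum.swap_inr, map_smul, map_sum, entryForm_single,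
      MvPolynomial.smul_eq_C_mul, mul_add, Finset.mul_sum (s := Finset.univ (α := _ × _)),
      ← Finset.sum_add_distrib, sub_eq_add_neg, ← Finset.sum_neg_distrib]
    congr 1 <;> refine Finset.sum_congr rfl fun p _ => ?_ <;>
      simp only [map_mul, map_pow, map_neg, map_ofNat] <;> ring
  rw [hdiff]
  exact Ideal.mul_mem_left _ _ (Ideal.sum_mem _ fun p _ => Ideal.sum_mem _ fun q _ =>
    X_mul_X_add_X_mul_X_mem_detIdeal _ _ _ _)

theorem affineMatrix_diagCoeff (c z : ℂ) (G : Fin N → Fin N → ℂ) :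
    affineMatrix (dualMean N k z) (diagCoeff N k c) (Function.uncurry G) =
      Matrix.blockDiagonal (Sum.elim (fun _ => c • Matrix.of G - z • 1)
        fun _ => c • (Matrix.of G).conjTranspose - conj z • 1) := by
  ext ⟨i, x⟩ ⟨j, y⟩
  simp only [affineMatrix, withConj, dualMean, diagCoeff, Matrix.add_apply, Matrix.sum_apply,
    Matrix.smul_apply, Matrix.single_apply, Matrix.blockDiagonal_apply, Matrix.diagonal_apply,
    Fintype.sum_sum_type, Sum.elim_inl, Sum.elim_inr, Fintype.sum_prod_type, Function.uncurry]
  rcases x with a | a <;> rcases y with b | b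
  · by_cases hab : a = b
    · subst hab
      simp [Matrix.one_apply, Finset.sum_ite_eq', ite_and, Matrix.sub_apply]
      split_ifs <;> ring
    · simp [hab, ite_and]
  · simp
  · simp
  · by_cases hab : a = b
    · subst hab
      simp [Matrix.one_apply, Finset.sum_ite_eq', ite_and, Matrix.sub_apply]
      split_ifs <;> ring
    · simp [hab, ite_and]

theorem affineMatrix_antidiagCoeff (c z : ℂ) (W : Fin k → Fin k → ℂ) :
    affineMatrix (dualMean N k z) (antidiagCoeff N k c) (Function.uncurry W) =
      (Matrix.blockDiagonal fun _ : Fin N => Matrix.fromBlocks (-z • 1) (c • Matrix.of W)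
        (-c • (Matrix.of W).conjTranspose) (-conj z • 1)).submatrix Prod.swap Prod.swap := by
  ext ⟨i, x⟩ ⟨j, y⟩
  simp only [affineMatrix, withConj, dualMean, antidiagCoeff, Matrix.add_apply, Matrix.sum_apply,
    Matrix.smul_apply, Matrix.single_apply, Matrix.blockDiagonal_apply, Matrix.diagonal_apply,
    Fintype.sum_sum_type, Sum.elim_inl, Sum.elim_inr, Fintype.sum_prod_type, Function.uncurry,
    Matrix.submatrix_apply, Prod.swap]
  by_cases hij : i = j
  · subst hij
    rcases x with a | a <;> rcases y with b | b <;>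
      simp [Matrix.one_apply, ite_and, neg_ite, mul_comm]
  · rcases x with a | a <;> rcases y with b | b <;>
      simp [hij, ite_and]

theorem det_blockDiagonal_sumElim_conjTranspose (A : Matrix (Fin N) (Fin N) ℂ) :
    (Matrix.blockDiagonal (Sum.elim (fun _ : Fin k => A)
      fun _ : Fin k => A.conjTranspose)).det = (‖A.det‖ ^ (2 * k) : ℝ) := by
  simp only [Matrix.det_blockDiagonal, Fintype.prod_sum_type, Sum.elim_inl, Sum.elim_inr,
    Finset.prod_const, Finset.card_univ, Fintype.card_fin, Matrix.det_conjTranspose]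
  rw [← mul_pow, ← starRingEnd_apply, Complex.mul_conj, Complex.normSq_eq_norm_sq, pow_mul]
  push_cast
  rfl

theorem det_submatrix_swap_blockDiagonal {m o R : Type*} [Fintype m] [DecidableEq m]
    [Fintype o] [DecidableEq o] [CommRing R] (A : Matrix m m R) :
    ((Matrix.blockDiagonal fun _ : o => A).submatrix Prod.swap Prod.swap).det =
      A.det ^ Fintype.card o := by
  rw [← Equiv.coe_prodComm, Matrix.det_submatrix_equiv_self, Matrix.det_blockDiagonal,
    Finset.prod_const, Finset.card_univ]

theorem det_fromBlocks_smul_one_of_mem_nonZeroDivisors {m R : Type*} [Fintype m] [DecidableEq m]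
    [CommRing R] (a : R) {d : R} (hd : d ∈ nonZeroDivisors R) (B C : Matrix m m R) :
    (Matrix.fromBlocks (a • 1) B C (d • 1)).det = ((a * d) • 1 - B * C).det := by
  have hmul : Matrix.fromBlocks (a • 1) B C (d • 1) * Matrix.fromBlocks (d • 1) 0 (-C) 1 =
      Matrix.fromBlocks ((a * d) • 1 - B * C) B 0 (d • 1) := by
    simp [Matrix.fromBlocks_multiply, smul_smul, sub_eq_add_neg, mul_comm d]
  have hdet := congrArg Matrix.det hmul
  rw [Matrix.det_mul, Matrix.det_fromBlocks_zero₁₂, Matrix.det_fromBlocks_zero₂₁, Matrix.det_one,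
    mul_one, Matrix.det_smul, Matrix.det_one, mul_one] at hdet
  exact mul_cancel_right_mem_nonZeroDivisors (pow_mem hd _) |>.1 hdet

theorem det_fromBlocks_smul_one {m R : Type*} [Fintype m] [DecidableEq m] [CommRing R]
    (a d : R) (B C : Matrix m m R) :
    (Matrix.fromBlocks (a • 1) B C (d • 1)).det = ((a * d) • 1 - B * C).det := by
  -- Perturbing `d` to `X + d` makes it a nonzerodivisor.
  have hX : (Polynomial.X + Polynomial.C d) ∈ nonZeroDivisors (Polynomial R) :=
    (Polynomial.monic_X_add_C d).mem_nonZeroDivisors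
  have h := congrArg (Polynomial.eval 0) (det_fromBlocks_smul_one_of_mem_nonZeroDivisors
    (Polynomial.C a) hX (B.map Polynomial.C) (C.map Polynomial.C))
  simp only [← Polynomial.coe_evalRingHom, RingHom.map_det, RingHom.mapMatrix_apply,
    Matrix.fromBlocks_map] at h
  have hC : ∀ A : Matrix m m R, (A.map Polynomial.C).map (Polynomial.evalRingHom 0) = A :=
    fun A => by ext; simp
  have hsmul : ∀ p : Polynomial R, (p • (1 : Matrix m m (Polynomial R))).map
      (Polynomial.evalRingHom 0) = p.eval 0 • (1 : Matrix m m R) := fun p => by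
    ext i j
    by_cases hij : i = j <;> simp [hij]
  rw [Matrix.map_sub _ (map_sub _), Matrix.map_mul] at h
  simpa only [hC, hsmul, Polynomial.eval_mul, Polynomial.eval_add, Polynomial.eval_X,
    Polynomial.eval_C, zero_add] using h

theorem integral_norm_det_pow_eq (N k : ℕ) (c : ℝ) (z : ℂ) :
    ((∫ G, ‖((c : ℂ) • Matrix.of G - z • (1 : Matrix (Fin N) (Fin N) ℂ)).det‖ ^ (2 * k)
      ∂(iidComplexNormal N) : ℝ) : ℂ) =
    ∫ W, ((‖z‖ ^ 2 : ℝ) • (1 : Matrix (Fin k) (Fin k) ℂ) +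
        (c ^ 2 : ℝ) • (Matrix.of W * (Matrix.of W).conjTranspose)).det ^ N
      ∂(iidComplexNormal k) := by
  have hdual := integral_det_affineMatrix_eq (hasComplexGaussianMoments_iidComplexNormal N)
    (hasComplexGaussianMoments_iidComplexNormal k) (dualMean N k z)
    (covarianceForm_diagCoeff_sub_antidiagCoeff_mem (c : ℂ))
  rw [← integral_complex_ofReal]
  refine Eq.trans (integral_congr_ae (ae_of_all _ fun G => ?_))
    (hdual.trans (integral_congr_ae (ae_of_all _ fun W => ?_)))
  · have hconj : (c : ℂ) • (Matrix.of G).conjTranspose - conj z • 1 =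
        ((c : ℂ) • Matrix.of G - z • (1 : Matrix (Fin N) (Fin N) ℂ)).conjTranspose := by
      simp [Matrix.conjTranspose_sub, Matrix.conjTranspose_smul, -Matrix.smul_of]
    simp only [affineMatrix_diagCoeff, hconj, det_blockDiagonal_sumElim_conjTranspose]
  · have hz : -z * -conj z = ((‖z‖ ^ 2 : ℝ) : ℂ) := by
      rw [neg_mul_neg, Complex.mul_conj, Complex.normSq_eq_norm_sq]
    simp only [affineMatrix_antidiagCoeff, det_submatrix_swap_blockDiagonal,
      det_fromBlocks_smul_one, Fintype.card_fin, hz, Matrix.smul_mul, Matrix.mul_smul, smul_smul]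
    congr 2
    simp only [neg_mul, neg_smul, sub_neg_eq_add, ← sq, ← Complex.ofReal_pow, Complex.coe_smul]

end Duality

section Radial

theorem lintegral_Ioi_comp_sq (f : ℝ → ℝ≥0∞) :
    ∫⁻ r in Set.Ioi (0 : ℝ), ENNReal.ofReal (2 * r) * f (r ^ 2) = ∫⁻ s in Set.Ioi (0 : ℝ), f s := by
  have himg : (fun r : ℝ => r ^ 2) '' Set.Ioi 0 = Set.Ioi 0 :=
    Set.Subset.antisymm (Set.image_subset_iff.2 fun _ hr => pow_pos (Set.mem_Ioi.1 hr) 2)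
      fun s hs => ⟨√s, Real.sqrt_pos.2 hs, Real.sq_sqrt (le_of_lt hs)⟩
  have hchange := lintegral_image_eq_lintegral_abs_deriv_mul (s := Set.Ioi (0 : ℝ))
    measurableSet_Ioi (f := fun r => r ^ 2) (f' := fun r => 2 * r)
    (fun x _ => by simpa using (hasDerivAt_pow 2 x).hasDerivWithinAt)
    (fun a ha b hb hab => (pow_left_inj₀ (le_of_lt ha) (le_of_lt hb) two_ne_zero).1 hab) f
  rw [himg] at hchange
  rw [hchange]
  refine setLIntegral_congr_fun measurableSet_Ioi fun r hr => ?_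
  rw [abs_of_pos (mul_pos two_pos (Set.mem_Ioi.1 hr))]

theorem lintegral_comp_norm_sq {f : ℝ → ℝ≥0∞} (hf : Measurable f) :
    ∫⁻ w : ℂ, f (‖w‖ ^ 2) = ENNReal.ofReal Real.pi * ∫⁻ s in Set.Ioi (0 : ℝ), f s := by
  rw [← Complex.lintegral_comp_polarCoord_symm, polarCoord_target, Measure.volume_eq_prod,
    ← Measure.prod_restrict]
  simp only [Complex.norm_polarCoord_symm, sq_abs, smul_eq_mul]
  rw [lintegral_prod _ (by fun_prop), ← lintegral_Ioi_comp_sq f,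
    ← lintegral_const_mul' _ _ ENNReal.ofReal_ne_top]
  refine lintegral_congr fun r => ?_
  dsimp only
  rw [lintegral_const, Measure.restrict_apply MeasurableSet.univ, Set.univ_inter, Real.volume_Ioo,
    show Real.pi - -Real.pi = 2 * Real.pi by ring, ENNReal.ofReal_mul zero_le_two,
    ENNReal.ofReal_mul zero_le_two]
  ring

theorem lintegral_Ioo_ofReal_pow (k : ℕ) (r : ℝ) :
    ∫⁻ s in Set.Ioo 0 r, ENNReal.ofReal (s ^ k) =
      (Set.Ioi 0).indicator (fun r => ENNReal.ofReal (r ^ (k + 1) / (k + 1))) r := by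
  rcases lt_or_ge 0 r with hr | hr
  · rw [Set.indicator_of_mem (Set.mem_Ioi.2 hr), ← ofReal_integral_eq_lintegral_ofReal]
    · rw [← integral_Ioc_eq_integral_Ioo, ← intervalIntegral.integral_of_le hr.le, integral_pow]
      simp
    · exact (continuous_pow k).integrableOn_Icc.mono_set Set.Ioo_subset_Icc_self
    · exact (ae_restrict_iff' measurableSet_Ioo).2 (ae_of_all _ fun s hs => pow_nonneg hs.1.le k)
  · rw [Set.indicator_of_notMem (by simpa using hr), Set.Ioo_eq_empty (not_lt.2 hr)]
    simp

theorem lintegral_Ioi_lintegral_Ioi_pow_mul_comp_add (k : ℕ) {f : ℝ → ℝ≥0∞} (hf : Measurable f) :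
    ∫⁻ t in Set.Ioi (0 : ℝ), ∫⁻ s in Set.Ioi (0 : ℝ), ENNReal.ofReal (s ^ k) * f (t + s) =
      ∫⁻ r in Set.Ioi (0 : ℝ), ENNReal.ofReal (r ^ (k + 1) / (k + 1)) * f r := by
  have htranslate (s : ℝ) : ∫⁻ t in Set.Ioi (0 : ℝ), ENNReal.ofReal (s ^ k) * f (t + s) =
      ∫⁻ r, (Set.Iio r).indicator (fun s => ENNReal.ofReal (s ^ k)) s * f r := by
    rw [← lintegral_indicator measurableSet_Ioi, ← lintegral_add_right_eq_self
      (fun r => (Set.Iio r).indicator (fun s => ENNReal.ofReal (s ^ k)) s * f r) s]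
    refine lintegral_congr fun t => ?_
    simp [Set.indicator_apply]
  have hmeas : Measurable fun p : ℝ × ℝ =>
      (Set.Iio p.2).indicator (fun s => ENNReal.ofReal (s ^ k)) p.1 * f p.2 :=
    (Measurable.ite (measurableSet_lt measurable_fst measurable_snd) (by fun_prop)
      measurable_const).mul (hf.comp measurable_snd)
  rw [lintegral_lintegral_swap (by fun_prop)]
  simp_rw [htranslate]
  rw [lintegral_lintegral_swap hmeas.aemeasurable, ← lintegral_indicator measurableSet_Ioi]
  refine lintegral_congr fun r => ?_
  rw [lintegral_mul_const _ (Measurable.indicator (by fun_prop) measurableSet_Iio),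
    setLIntegral_indicator measurableSet_Iio, Set.inter_comm, Set.Ioi_inter_Iio,
    lintegral_Ioo_ofReal_pow, Set.indicator_mul_left]

theorem lintegral_comp_sum_norm_sq (k : ℕ) {f : ℝ → ℝ≥0∞} (hf : Measurable f) :
    ∫⁻ w : Fin (k + 1) → ℂ, f (∑ i, ‖w i‖ ^ 2) =
      ENNReal.ofReal (Real.pi ^ (k + 1) / k.factorial) *
        ∫⁻ s in Set.Ioi (0 : ℝ), ENNReal.ofReal (s ^ k) * f s := by
  induction k generalizing f with
  | zero =>
    rw [volume_pi, lintegral_pi_fin_succ _ _ (by fun_prop)]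
    simp [lintegral_comp_norm_sq hf, Measure.pi_of_empty _ Fin.elim0]
  | succ k ih =>
    have hslice : Measurable fun t : ℝ =>
        ∫⁻ s in Set.Ioi (0 : ℝ), ENNReal.ofReal (s ^ k) * f (t + s) :=
      Measurable.lintegral_prod_right'
        (f := fun p : ℝ × ℝ => ENNReal.ofReal (p.2 ^ k) * f (p.1 + p.2)) (by fun_prop)
    rw [volume_pi, lintegral_pi_fin_succ _ _ (by fun_prop), ← volume_pi]
    simp only [Fin.sum_univ_succ (n := k + 1), Fin.cons_zero, Fin.cons_succ]
    rw [lintegral_congr fun a => ih (f := fun s => f (‖a‖ ^ 2 + s)) (by fun_prop),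
      lintegral_const_mul' _ _ ENNReal.ofReal_ne_top, lintegral_comp_norm_sq hslice,
      lintegral_Ioi_lintegral_Ioi_pow_mul_comp_add k hf, ← mul_assoc,
      ← ENNReal.ofReal_mul (by positivity), ← lintegral_const_mul' _ _ ENNReal.ofReal_ne_top,
      ← lintegral_const_mul' _ _ ENNReal.ofReal_ne_top]
    refine lintegral_congr fun r => ?_
    rw [← mul_assoc, ← mul_assoc, ← ENNReal.ofReal_mul (by positivity),
      ← ENNReal.ofReal_mul (by positivity), Nat.factorial_succ]
    congr 2
    push_cast
    field_simp
    ring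

end Radial

section Unitary

open Matrix

theorem measurePreserving_vecMul_unitary {n : Type*} [Fintype n] [DecidableEq n]
    {U : Matrix n n ℂ} (hU : U * Uᴴ = 1) :
    MeasurePreserving (fun v : n → ℂ => v ᵥ* U) := by
  let f : (n → ℂ) →ₗ[ℝ] (n → ℂ) := (Matrix.toLin' Uᵀ).restrictScalars ℝ
  have hdet : LinearMap.det f = 1 := by
    have hU' : U.det * conj U.det = 1 := by
      rw [starRingEnd_apply, ← Matrix.det_conjTranspose, ← Matrix.det_mul, hU, Matrix.det_one]
    rw [LinearMap.det_restrictScalars, LinearMap.det_toLin', Matrix.det_transpose,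
      Algebra.norm_complex_apply]
    exact_mod_cast (Complex.mul_conj _).symm.trans hU'
  have hmap := Measure.map_linearMap_addHaar_eq_smul_addHaar volume (f := f) (by simp [hdet])
  rw [hdet, inv_one, abs_one, ENNReal.ofReal_one, one_smul] at hmap
  have hf : (fun v : n → ℂ => v ᵥ* U) = f := by
    funext v
    simp [f, Matrix.mulVec_transpose]
  exact hf ▸ ⟨f.continuous_of_finiteDimensional.measurable, hmap⟩

theorem exists_unitary_vecMul_eq {k : ℕ} (w : Fin (k + 1) → ℂ) :
    ∃ U : Matrix (Fin (k + 1)) (Fin (k + 1)) ℂ, U * Uᴴ = 1 ∧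
      w ᵥ* U = Pi.single 0 (√(∑ i, ‖w i‖ ^ 2) : ℂ) := by
  rcases eq_or_ne w 0 with rfl | hw
  · exact ⟨1, by simp, by simp⟩
  let x : EuclideanSpace ℂ (Fin (k + 1)) := WithLp.toLp 2 w
  have hx : x ≠ 0 := fun h => hw (by simpa [x] using h)
  have hnorm : ‖x‖ = √(∑ i, ‖w i‖ ^ 2) := EuclideanSpace.norm_eq x
  have hunit : Orthonormal ℂ (({0} : Set (Fin (k + 1))).domRestrict fun _ => (‖x‖ : ℂ)⁻¹ • x) := by
    refine ⟨fun _ => norm_smul_inv_norm hx, fun i j hij => absurd (Subtype.ext ?_) hij⟩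
    rw [Set.mem_singleton_iff.1 i.2, Set.mem_singleton_iff.1 j.2]
  obtain ⟨b, hb⟩ := hunit.exists_orthonormalBasis_extension_of_card_eq (by simp)
  have hxb : x = (‖x‖ : ℂ) • b 0 := by
    rw [hb 0 rfl, smul_inv_smul₀ (by exact_mod_cast norm_ne_zero_iff.2 hx)]
  refine ⟨Matrix.of fun i j => conj (b j i), ?_, ?_⟩
  · rw [mul_eq_one_comm]
    ext i j
    have hinner := b.inner_eq_ite j i
    rw [PiLp.inner_apply] at hinner
    simp only [Matrix.mul_apply, Matrix.conjTranspose_apply, Matrix.of_apply, Matrix.one_apply,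
      eq_comm (a := i), ← hinner]
    exact Finset.sum_congr rfl fun l _ => by simp
  · ext j
    have hinner : inner ℂ (b j) x = if j = 0 then (‖x‖ : ℂ) else 0 := by
      rw [hxb, inner_smul_right, b.inner_eq_ite]
      simp [← hxb]
    rw [PiLp.inner_apply] at hinner
    rw [← hnorm, Pi.single_apply, ← hinner, vecMul, dotProduct]
    exact Finset.sum_congr rfl fun l _ => by simp [x]

end Unitary

section Bordered

open Matrix
open scoped ComplexOrder

/-- The matrix obtained from `H` by adding a first row `(s, v)` and a first column `(s, conj v)`. -/
def borderedMatrix {k : ℕ} (s : ℝ) (v : Fin k → ℂ) (H : Matrix (Fin k) (Fin k) ℂ) :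
    Matrix (Fin (k + 1)) (Fin (k + 1)) ℂ :=
  Matrix.of (Fin.cons (Fin.cons (s : ℂ) v) fun i => Fin.cons (conj (v i)) (H i))

variable {k : ℕ} {s : ℝ} {v : Fin k → ℂ} {H : Matrix (Fin k) (Fin k) ℂ}

@[simp] theorem borderedMatrix_zero_zero : borderedMatrix s v H 0 0 = s := rfl

@[simp] theorem borderedMatrix_zero_succ (j : Fin k) : borderedMatrix s v H 0 j.succ = v j := rfl

@[simp] theorem borderedMatrix_succ_zero (i : Fin k) :
    borderedMatrix s v H i.succ 0 = conj (v i) := rfl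

@[simp] theorem borderedMatrix_succ_succ (i j : Fin k) :
    borderedMatrix s v H i.succ j.succ = H i j := rfl

theorem dotProduct_borderedMatrix_mulVec (hs : s ≠ 0) (a : ℂ) (y : Fin k → ℂ) :
    star (Fin.cons a y : Fin (k + 1) → ℂ) ⬝ᵥ (borderedMatrix s v H *ᵥ Fin.cons a y) =
      ((s * ‖a + (s : ℂ)⁻¹ * (v ⬝ᵥ y)‖ ^ 2 : ℝ) : ℂ) +
        star y ⬝ᵥ ((H - (s : ℂ)⁻¹ • vecMulVec (star v) v) *ᵥ y) := by
  have hs' : (s : ℂ) ≠ 0 := by exact_mod_cast hs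
  have hconj : star y ⬝ᵥ star v = conj (v ⬝ᵥ y) := by
    simp [dotProduct, mul_comm]
  have hexpand : star (Fin.cons a y : Fin (k + 1) → ℂ) ⬝ᵥ (borderedMatrix s v H *ᵥ Fin.cons a y) =
      conj a * (s * a + v ⬝ᵥ y) + (star y ⬝ᵥ star v) * a + star y ⬝ᵥ (H *ᵥ y) := by
    simp only [mulVec, dotProduct, Fin.sum_univ_succ, borderedMatrix_zero_zero,
      borderedMatrix_zero_succ, borderedMatrix_succ_zero, borderedMatrix_succ_succ, mul_add,
      Finset.sum_add_distrib, Pi.star_apply, Finset.sum_mul, RCLike.star_def, Fin.cons_zero,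
      Fin.cons_succ, mul_assoc]
    ring
  rw [hexpand, sub_mulVec, dotProduct_sub, smul_mulVec, dotProduct_smul, vecMulVec_mulVec,
    op_smul_eq_smul, dotProduct_smul, smul_eq_mul, smul_eq_mul, hconj]
  push_cast
  rw [← Complex.mul_conj', map_add, map_mul, map_inv₀, Complex.conj_ofReal]
  field_simp
  ring

theorem isHermitian_borderedMatrix_iff : (borderedMatrix s v H).IsHermitian ↔ H.IsHermitian := by
  refine ⟨fun h => ?_, fun h => ?_⟩
  · ext i j
    simpa using congr_fun₂ h i.succ j.succ
  · ext i j
    cases i using Fin.cases <;> cases j using Fin.cases <;>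
      simp [show ∀ i j, conj (H j i) = H i j from fun i j => h.apply i j]

theorem posDef_borderedMatrix_iff : (borderedMatrix s v H).PosDef ↔
    0 < s ∧ (H - (s : ℂ)⁻¹ • vecMulVec (star v) v).PosDef := by
  have hrankOne : ((s : ℂ)⁻¹ • vecMulVec (star v) v).IsHermitian := by
    ext i j
    simp [vecMulVec_apply, mul_comm]
  rw [posDef_iff_dotProduct_mulVec, posDef_iff_dotProduct_mulVec, isHermitian_borderedMatrix_iff]
  constructor
  · rintro ⟨hH, hpos⟩
    have hs : 0 < s := by simpa using hpos (x := Pi.single 0 1) (by simp)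
    refine ⟨hs, hH.sub hrankOne, fun y hy => ?_⟩
    have hpos' := hpos (x := Fin.cons (-((s : ℂ)⁻¹ * (v ⬝ᵥ y))) y) fun h0 =>
      hy (funext fun i => congr_fun h0 i.succ)
    rw [dotProduct_borderedMatrix_mulVec hs.ne'] at hpos'
    simpa using hpos'
  · rintro ⟨hs, hH, hpos⟩
    refine ⟨by simpa using hH.add hrankOne, fun {x} hx => ?_⟩
    obtain ⟨a, y, rfl⟩ : ∃ a y, x = Fin.cons a y := ⟨x 0, Fin.tail x, (Fin.cons_self_tail x).symm⟩
    rw [dotProduct_borderedMatrix_mulVec hs.ne']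
    rcases eq_or_ne y 0 with rfl | hy
    · have ha : a ≠ 0 := fun h0 => hx (by rw [h0]; exact Fin.cons_self_tail 0)
      have hsq : (0 : ℂ) < ((s * ‖a‖ ^ 2 : ℝ) : ℂ) := by exact_mod_cast (by positivity)
      simpa using hsq
    · exact add_pos_of_nonneg_of_pos (by exact_mod_cast (by positivity)) (hpos hy)

end Bordered

section HermitianCoordinates

variable {k : ℕ}

/-- The index pairs above the diagonal of a `(k + 1) × (k + 1)` matrix: those in the first row
and those of the lower right `k × k` block. -/
def upperPairsSuccEquiv (k : ℕ) : Fin k ⊕ {p : Fin k × Fin k // p.1 < p.2} ≃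
    {p : Fin (k + 1) × Fin (k + 1) // p.1 < p.2} where
  toFun := Sum.elim (fun j => ⟨(0, j.succ), Fin.succ_pos j⟩)
    fun p => ⟨(p.1.1.succ, p.1.2.succ), Fin.succ_lt_succ_iff.2 p.2⟩
  invFun p := if h : p.1.1 = 0 then Sum.inl (p.1.2.pred (Fin.ne_zero_of_lt p.2))
    else Sum.inr ⟨(p.1.1.pred h, p.1.2.pred (Fin.ne_zero_of_lt p.2)), by simpa using p.2⟩
  left_inv x := by
    rcases x with j | p <;> simp
  right_inv p := by
    rcases p with ⟨⟨i, j⟩, h⟩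
    rcases eq_or_ne i 0 with rfl | hi
    · simp
    · simp [hi]

/-- The entries of the bordered Hermitian matrix with corner `s`, first row `(s, v)` and remaining
block given by the entries `h`. -/
def hermitianCons (s : ℝ) (v : Fin k → ℂ) (h : HermitianEntries k) : HermitianEntries (k + 1) :=
  (Fin.cons s h.1, fun p => Sum.elim v h.2 ((upperPairsSuccEquiv k).symm p))

theorem hermitianOfEntries_hermitianCons (s : ℝ) (v : Fin k → ℂ) (h : HermitianEntries k) :
    hermitianOfEntries (hermitianCons s v h) = borderedMatrix s v (hermitianOfEntries h) := by
  ext i j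
  cases i using Fin.cases <;> cases j using Fin.cases <;>
    simp [hermitianOfEntries, hermitianCons, upperPairsSuccEquiv]

@[fun_prop]
theorem measurable_hermitianCons {α : Type*} [MeasurableSpace α] {s : α → ℝ} {v : α → Fin k → ℂ}
    {h : α → HermitianEntries k} (hs : Measurable s) (hv : Measurable v) (hh : Measurable h) :
    Measurable fun x => hermitianCons (s x) (v x) (h x) := by
  refine ((measurable_fin_cons k).comp (hs.prodMk hh.fst)).prodMk (measurable_pi_iff.2 fun p => ?_)
  rcases (upperPairsSuccEquiv k).symm p with j | q
  · exact measurable_pi_iff.1 hv j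
  · exact measurable_pi_iff.1 hh.snd q

theorem measurePreserving_sumElim_comp_upperPairsSuccEquiv_symm (k : ℕ) : MeasurePreserving
    fun (x : (Fin k → ℂ) × ({p : Fin k × Fin k // p.1 < p.2} → ℂ)) p =>
      Sum.elim x.1 x.2 ((upperPairsSuccEquiv k).symm p) := by
  have hcomp : (fun (x : (Fin k → ℂ) × ({p : Fin k × Fin k // p.1 < p.2} → ℂ)) p =>
      Sum.elim x.1 x.2 ((upperPairsSuccEquiv k).symm p)) =
      MeasurableEquiv.piCongrLeft (fun _ => ℂ) (upperPairsSuccEquiv k) ∘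
        (MeasurableEquiv.sumPiEquivProdPi fun _ => ℂ).symm := by
    funext x p
    obtain ⟨q, rfl⟩ := (upperPairsSuccEquiv k).surjective p
    rw [Equiv.symm_apply_apply, Function.comp_apply, MeasurableEquiv.coe_piCongrLeft,
      Equiv.piCongrLeft_apply_apply]
    cases q <;> rfl
  rw [hcomp]
  exact (volume_measurePreserving_piCongrLeft _ _).comp
    (volume_measurePreserving_sumPiEquivProdPi _).symm

theorem lintegral_hermitianEntries_succ {f : HermitianEntries (k + 1) → ℝ≥0∞} (hf : Measurable f) :
    ∫⁻ h, f h = ∫⁻ s : ℝ, ∫⁻ v : Fin k → ℂ, ∫⁻ h : HermitianEntries k, f (hermitianCons s v h) := by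
  have hmp := measurePreserving_sumElim_comp_upperPairsSuccEquiv_symm k
  have hsplit (s : ℝ) (a : Fin k → ℝ) :
      ∫⁻ b : {p : Fin (k + 1) × Fin (k + 1) // p.1 < p.2} → ℂ, f (Fin.cons s a, b) =
        ∫⁻ v : Fin k → ℂ, ∫⁻ b : {p : Fin k × Fin k // p.1 < p.2} → ℂ,
          f (hermitianCons s v (a, b)) := by
    have hfa : Measurable fun b : {p : Fin (k + 1) × Fin (k + 1) // p.1 < p.2} → ℂ =>
      f (Fin.cons s a, b) := hf.comp measurable_prodMk_left
    rw [← hmp.lintegral_comp hfa]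
    exact lintegral_prod _ (hfa.comp hmp.measurable).aemeasurable
  have hslice : Measurable fun a : Fin (k + 1) → ℝ =>
      ∫⁻ b : {p : Fin (k + 1) × Fin (k + 1) // p.1 < p.2} → ℂ, f (a, b) :=
    hf.lintegral_prod_right'
  rw [Measure.volume_eq_prod, lintegral_prod _ hf.aemeasurable, volume_pi,
    lintegral_pi_fin_succ _ _ hslice]
  refine lintegral_congr fun s => ?_
  have hjoint : Measurable fun x : ((Fin k → ℝ) × (Fin k → ℂ)) ×
      ({p : Fin k × Fin k // p.1 < p.2} → ℂ) => f (hermitianCons s x.1.2 (x.1.1, x.2)) :=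
    hf.comp (by fun_prop)
  simp_rw [← volume_pi, hsplit]
  rw [lintegral_lintegral_swap hjoint.lintegral_prod_right'.aemeasurable]
  exact lintegral_congr fun v => (lintegral_prod (fun h => f (hermitianCons s v h))
    (hf.comp (by fun_prop)).aemeasurable).symm

end HermitianCoordinates

section Wishart

open Matrix
open scoped ComplexOrder

variable {k : ℕ}

theorem hermitianOfEntries_add (h h' : HermitianEntries k) :
    hermitianOfEntries (h + h') = hermitianOfEntries h + hermitianOfEntries h' := by
  ext i j
  simp only [hermitianOfEntries, Matrix.of_apply, Matrix.add_apply]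
  split_ifs <;> simp

theorem hermitianOfEntries_smul (r : ℝ) (h : HermitianEntries k) :
    hermitianOfEntries (r • h) = r • hermitianOfEntries h := by
  ext i j
  simp only [hermitianOfEntries, Matrix.of_apply, Matrix.smul_apply]
  split_ifs <;> simp

@[fun_prop]
theorem continuous_hermitianOfEntries : Continuous (hermitianOfEntries (k := k)) := by
  refine continuous_matrix fun i j => ?_
  simp only [hermitianOfEntries, Matrix.of_apply]
  split_ifs <;> fun_prop

/-- The diagonal entries (their real parts) and the entries above the diagonal of a square matrix;
an inverse of `hermitianOfEntries` on Hermitian matrices. -/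
def entriesOfMatrix (M : Matrix (Fin k) (Fin k) ℂ) : HermitianEntries k :=
  (fun i => (M i i).re, fun p => M p.1.1 p.1.2)

theorem hermitianOfEntries_entriesOfMatrix {M : Matrix (Fin k) (Fin k) ℂ} (hM : M.IsHermitian) :
    hermitianOfEntries (entriesOfMatrix M) = M := by
  ext i j
  simp only [hermitianOfEntries, entriesOfMatrix, Matrix.of_apply]
  split_ifs with hij hji
  · rfl
  · exact hM.apply i j
  · obtain rfl : i = j := le_antisymm (not_lt.1 hji) (not_lt.1 hij)
    exact Complex.conj_eq_iff_re.1 (hM.apply i i)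

theorem entriesOfMatrix_hermitianOfEntries (h : HermitianEntries k) :
    entriesOfMatrix (hermitianOfEntries h) = h := by
  ext i
  · simp [entriesOfMatrix, hermitianOfEntries]
  · simp [entriesOfMatrix, hermitianOfEntries, i.2]

/-- The cone of positive definite matrices, in the coordinates of `hermitianOfEntries`. -/
def posDefCone (k : ℕ) : Set (HermitianEntries k) := {h | (hermitianOfEntries h).PosDef}

theorem isClosed_setOf_posSemidef {n : Type*} [Finite n] :
    IsClosed {A : Matrix n n ℂ | A.PosSemidef} := by
  have := Fintype.ofFinite n
  simp_rw [posSemidef_iff_dotProduct_mulVec, Set.ofPred_and, Set.ofPred_forall]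
  refine (isClosed_eq (by fun_prop) continuous_id).inter (isClosed_iInter fun x => ?_)
  exact isClosed_le continuous_const (by fun_prop)

theorem measurableSet_posDefCone (k : ℕ) : MeasurableSet (posDefCone k) := by
  have hinter : posDefCone k = hermitianOfEntries ⁻¹' {A | A.PosSemidef} ∩
      (fun h => (hermitianOfEntries h).det) ⁻¹' {0}ᶜ := by
    ext h
    refine ⟨fun hpos => ⟨hpos.posSemidef, hpos.det_pos.ne'⟩, fun ⟨hpos, hdet⟩ => ?_⟩
    exact hpos.posDef_iff_isUnit.2 ((isUnit_iff_isUnit_det _).2 (isUnit_iff_ne_zero.2 hdet))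
  rw [hinter]
  exact (isClosed_setOf_posSemidef.preimage (by fun_prop)).measurableSet.inter
    (isClosed_singleton.isOpen_compl.preimage (by fun_prop)).measurableSet

/-- The entries of the Gram matrix `W Wᴴ` of the rows of `W`. -/
def gramEntries (W : Fin k → Fin k → ℂ) : HermitianEntries k :=
  entriesOfMatrix (Matrix.of W * (Matrix.of W)ᴴ)

theorem hermitianOfEntries_gramEntries (W : Fin k → Fin k → ℂ) :
    hermitianOfEntries (gramEntries W) = Matrix.of W * (Matrix.of W)ᴴ :=
  hermitianOfEntries_entriesOfMatrix (isHermitian_mul_conjTranspose_self _)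

@[fun_prop]
theorem measurable_gramEntries : Measurable (gramEntries (k := k)) := by
  refine Continuous.measurable ?_
  unfold gramEntries entriesOfMatrix
  simp only [Matrix.mul_apply, conjTranspose_apply, Matrix.of_apply]
  fun_prop

theorem gramEntries_vecMul_unitary {U : Matrix (Fin k) (Fin k) ℂ} (hU : U * Uᴴ = 1)
    (W : Fin k → Fin k → ℂ) : gramEntries (fun i => W i ᵥ* U) = gramEntries W := by
  have hmul : Matrix.of (fun i => W i ᵥ* U) = Matrix.of W * U := rfl
  rw [gramEntries, gramEntries, hmul, conjTranspose_mul, Matrix.mul_assoc, ← Matrix.mul_assoc U,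
    hU, Matrix.one_mul]

theorem gramEntries_cons_single {s : ℝ} (hs : 0 ≤ s) (u : Fin k → ℂ) (R : Fin k → Fin k → ℂ) :
    gramEntries (Fin.cons (Pi.single 0 (√s : ℂ)) fun i => Fin.cons (u i) (R i)) =
      hermitianCons s (√s • star u) (entriesOfMatrix (vecMulVec u (star u)) + gramEntries R) := by
  rw [gramEntries, ← entriesOfMatrix_hermitianOfEntries (hermitianCons _ _ _),
    hermitianOfEntries_hermitianCons, hermitianOfEntries_add, hermitianOfEntries_gramEntries,
    hermitianOfEntries_entriesOfMatrix (posSemidef_vecMulVec_self_star u).isHermitian]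
  congr 1
  ext i j
  rw [Matrix.mul_apply, Fin.sum_univ_succ]
  cases i using Fin.cases <;> cases j using Fin.cases
  · simp [← Complex.ofReal_mul, Real.mul_self_sqrt hs]
  · simp
  · simp [mul_comm]
  · simp [vecMulVec_apply, Matrix.mul_apply]

theorem pos_of_hermitianCons_mem_posDefCone {s : ℝ} {v : Fin k → ℂ} {h : HermitianEntries k}
    (hmem : hermitianCons s v h ∈ posDefCone (k + 1)) : 0 < s := by
  rw [posDefCone, Set.mem_ofPred_eq, hermitianOfEntries_hermitianCons,
    posDef_borderedMatrix_iff] at hmem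
  exact hmem.1

theorem hermitianCons_sqrt_smul_star_mem_posDefCone {s : ℝ} (hs : 0 < s) (u : Fin k → ℂ)
    (h : HermitianEntries k) :
    hermitianCons s (√s • star u) (entriesOfMatrix (vecMulVec u (star u)) + h) ∈
      posDefCone (k + 1) ↔ h ∈ posDefCone k := by
  have hrankOne : (s : ℂ)⁻¹ • vecMulVec (star (√s • star u)) (√s • star u) =
      vecMulVec u (star u) := by
    rw [star_smul, star_star, star_trivial, smul_vecMulVec, vecMulVec_smul, smul_smul,
      Real.mul_self_sqrt hs.le, ← Complex.ofReal_inv, Complex.coe_smul,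
      inv_smul_smul₀ hs.ne']
  rw [posDefCone, posDefCone, Set.mem_ofPred_eq, Set.mem_ofPred_eq,
    hermitianOfEntries_hermitianCons, posDef_borderedMatrix_iff, hrankOne, hermitianOfEntries_add,
    hermitianOfEntries_entriesOfMatrix (posSemidef_vecMulVec_self_star u).isHermitian,
    add_sub_cancel_left, and_iff_right hs]

theorem measurePreserving_cons_columns (k : ℕ) : MeasurePreserving
    fun (x : (Fin k → ℂ) × (Fin k → Fin k → ℂ)) i =>
      (Fin.cons (x.1 i) (x.2 i) : Fin (k + 1) → ℂ) := by
  have hcomp : (fun (x : (Fin k → ℂ) × (Fin k → Fin k → ℂ)) i =>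
      (Fin.cons (x.1 i) (x.2 i) : Fin (k + 1) → ℂ)) =
      (fun (x : Fin k → ℂ × (Fin k → ℂ)) i =>
        (MeasurableEquiv.piFinSuccAbove (fun _ : Fin (k + 1) => ℂ) 0).symm (x i)) ∘
      (MeasurableEquiv.arrowProdEquivProdArrow ℂ (Fin k → ℂ) (Fin k)).symm := by
    funext x i
    exact (Fin.insertNth_zero' (x.1 i) (x.2 i)).symm
  rw [hcomp]
  exact (volume_preserving_pi fun _ => (volume_preserving_piFinSuccAbove _ 0).symm).comp
    (volume_measurePreserving_arrowProdEquivProdArrow ℂ (Fin k → ℂ) (Fin k)).symm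

theorem lintegral_comp_smul_star {r : ℝ} (hr : r ≠ 0) {f : (Fin k → ℂ) → ℝ≥0∞}
    (hf : Measurable f) :
    ∫⁻ u, f (r • star u) = ENNReal.ofReal ((r ^ 2) ^ k)⁻¹ * ∫⁻ v, f v := by
  have hstar : MeasurePreserving fun u : Fin k → ℂ => star u :=
    volume_preserving_pi fun _ => Complex.conjLIE.measurePreserving
  have hsmul : Measurable fun u : Fin k → ℂ => r • u := measurable_const_smul r
  have hrank : Module.finrank ℝ (Fin k → ℂ) = 2 * k := by
    rw [Module.finrank_pi_fintype]
    simp [mul_comm]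
  have hdrop : ∫⁻ u, f (r • star u) = ∫⁻ u, f (r • u) := hstar.lintegral_comp (hf.comp hsmul)
  rw [hdrop, ← lintegral_map hf hsmul, Measure.map_addHaar_smul _ hr, lintegral_smul_measure,
    smul_eq_mul, hrank, pow_mul, abs_of_nonneg (by positivity)]

/-- The constant by which `W ↦ W Wᴴ` scales Lebesgue measure, from square matrices to positive
definite ones. -/
def wishartConst (k : ℕ) : ℝ := ∏ j ∈ Finset.range k, Real.pi ^ (j + 1) / j.factorial

theorem wishartConst_pos (k : ℕ) : 0 < wishartConst k :=
  Finset.prod_pos fun j _ => by positivity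

theorem lintegral_gramEntries_cons_eq {f : HermitianEntries (k + 1) → ℝ≥0∞} (hf : Measurable f)
    (w : Fin (k + 1) → ℂ) :
    ∫⁻ R : Fin k → Fin (k + 1) → ℂ, f (gramEntries (Fin.cons w R)) =
      ∫⁻ R, f (gramEntries (Fin.cons (Pi.single 0 (√(∑ i, ‖w i‖ ^ 2) : ℂ)) R)) := by
  obtain ⟨U, hU, hw⟩ := exists_unitary_vecMul_eq w
  have hrotate : MeasurePreserving fun (R : Fin k → Fin (k + 1) → ℂ) i => R i ᵥ* U :=
    volume_preserving_pi fun _ => measurePreserving_vecMul_unitary hU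
  have hmeas (a : Fin (k + 1) → ℂ) :
      Measurable fun R : Fin k → Fin (k + 1) → ℂ => f (gramEntries (Fin.cons a R)) :=
    (hf.comp measurable_gramEntries).comp ((measurable_fin_cons k).comp measurable_prodMk_left)
  rw [← hrotate.lintegral_comp (hmeas (Pi.single 0 _)), ← hw]
  refine lintegral_congr fun R => congrArg f ?_
  rw [← gramEntries_vecMul_unitary hU (Fin.cons w R)]
  congr 1
  funext i
  cases i using Fin.cases <;> rfl

theorem lintegral_gramEntries_cons_single {f : HermitianEntries (k + 1) → ℝ≥0∞}
    (hf : Measurable f) {s : ℝ} (hs : 0 ≤ s) :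
    ∫⁻ R : Fin k → Fin (k + 1) → ℂ, f (gramEntries (Fin.cons (Pi.single 0 (√s : ℂ)) R)) =
      ∫⁻ u : Fin k → ℂ, ∫⁻ R : Fin k → Fin k → ℂ, f (hermitianCons s (√s • star u)
        (entriesOfMatrix (vecMulVec u (star u)) + gramEntries R)) := by
  have hmeas : Measurable fun R : Fin k → Fin (k + 1) → ℂ =>
      f (gramEntries (Fin.cons (Pi.single 0 (√s : ℂ)) R)) :=
    (hf.comp measurable_gramEntries).comp ((measurable_fin_cons k).comp measurable_prodMk_left)
  have hcolumns := measurePreserving_cons_columns k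
  rw [← hcolumns.lintegral_comp hmeas]
  refine (lintegral_prod _ (hmeas.comp hcolumns.measurable).aemeasurable).trans ?_
  simp only [Function.comp_apply, gramEntries_cons_single hs]

instance (k : ℕ) : (volume : Measure (HermitianEntries k)).IsAddHaarMeasure :=
  Measure.prod.instIsAddHaarMeasure _ _

theorem lintegral_setLIntegral_posDefCone_hermitianCons {f : HermitianEntries (k + 1) → ℝ≥0∞}
    (hf : Measurable f) {s : ℝ} (hs : 0 < s) :
    ∫⁻ u : Fin k → ℂ, ∫⁻ h in posDefCone k,
        f (hermitianCons s (√s • star u) (entriesOfMatrix (vecMulVec u (star u)) + h)) =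
      ENNReal.ofReal (s ^ k)⁻¹ * ∫⁻ v : Fin k → ℂ, ∫⁻ h : HermitianEntries k,
        (posDefCone (k + 1)).indicator f (hermitianCons s v h) := by
  have hf' := hf.indicator (measurableSet_posDefCone (k + 1))
  have hslice : Measurable fun v : Fin k → ℂ => ∫⁻ h : HermitianEntries k,
      (posDefCone (k + 1)).indicator f (hermitianCons s v h) :=
    Measurable.lintegral_prod_right' (f := fun x : (Fin k → ℂ) × HermitianEntries k =>
      (posDefCone (k + 1)).indicator f (hermitianCons s x.1 x.2)) (hf'.comp (by fun_prop))
  have hscale := lintegral_comp_smul_star (Real.sqrt_pos.2 hs).ne' hslice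
  rw [Real.sq_sqrt hs.le] at hscale
  rw [← hscale]
  refine lintegral_congr fun u => ?_
  rw [← lintegral_indicator (measurableSet_posDefCone k),
    ← lintegral_add_left_eq_self
      (fun h => (posDefCone (k + 1)).indicator f (hermitianCons s (√s • star u) h))
      (entriesOfMatrix (vecMulVec u (star u)))]
  refine lintegral_congr fun h => ?_
  classical
  simp only [Set.indicator_apply, hermitianCons_sqrt_smul_star_mem_posDefCone hs]

theorem setLIntegral_posDefCone_succ {f : HermitianEntries (k + 1) → ℝ≥0∞} (hf : Measurable f) :
    ∫⁻ h in posDefCone (k + 1), f h = ∫⁻ s in Set.Ioi (0 : ℝ), ∫⁻ v : Fin k → ℂ,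
      ∫⁻ h : HermitianEntries k, (posDefCone (k + 1)).indicator f (hermitianCons s v h) := by
  rw [← lintegral_indicator (measurableSet_posDefCone (k + 1)), lintegral_hermitianEntries_succ
    (hf.indicator (measurableSet_posDefCone (k + 1))), ← lintegral_indicator measurableSet_Ioi]
  refine lintegral_congr fun s => ?_
  by_cases hs : 0 < s
  · rw [Set.indicator_of_mem (Set.mem_Ioi.2 hs)]
  · have hzero (v : Fin k → ℂ) (h : HermitianEntries k) :
        (posDefCone (k + 1)).indicator f (hermitianCons s v h) = 0 :=
      Set.indicator_of_notMem (fun hmem => hs (pos_of_hermitianCons_mem_posDefCone hmem)) f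
    simp [hzero, hs]

theorem lintegral_gramEntries_zero (f : HermitianEntries 0 → ℝ≥0∞) :
    ∫⁻ W, f (gramEntries W) = ∫⁻ h in posDefCone 0, f h := by
  have hcone : posDefCone 0 = Set.univ := Set.eq_univ_of_forall fun h =>
    posDef_iff_dotProduct_mulVec.2 ⟨isHermitian_hermitianOfEntries _,
      fun {x} hx => absurd (Subsingleton.elim x 0) hx⟩
  have hf0 (h : HermitianEntries 0) : f h = f 0 := congrArg f (Subsingleton.elim h 0)
  have hvol : (volume : Measure (HermitianEntries 0)) Set.univ = 1 := by
    rw [Measure.volume_eq_prod, ← Set.univ_prod_univ, Measure.prod_prod, volume_pi, volume_pi,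
      Measure.pi_univ, Measure.pi_univ]
    simp
  simp [hf0, hcone, hvol, volume_pi]

theorem lintegral_gramEntries (k : ℕ) {f : HermitianEntries k → ℝ≥0∞} (hf : Measurable f) :
    ∫⁻ W, f (gramEntries W) = ENNReal.ofReal (wishartConst k) * ∫⁻ h in posDefCone k, f h := by
  induction k with
  | zero => simpa [wishartConst] using lintegral_gramEntries_zero f
  | succ k ih =>
    have hgram : Measurable fun W => f (gramEntries W) := hf.comp measurable_gramEntries
    have hslice : Measurable fun s : ℝ => ∫⁻ R : Fin k → Fin (k + 1) → ℂ,
        f (gramEntries (Fin.cons (Pi.single 0 (√s : ℂ)) R)) := by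
      refine Measurable.lintegral_prod_right' (f := fun x : ℝ × (Fin k → Fin (k + 1) → ℂ) =>
        f (gramEntries (Fin.cons (Pi.single 0 (√x.1 : ℂ)) x.2))) ?_
      refine hgram.comp ((measurable_fin_cons k).comp (Measurable.prodMk ?_ measurable_snd))
      exact ((continuous_single 0).comp (by fun_prop : Continuous fun s : ℝ × _ =>
        (√s.1 : ℂ))).measurable
    rw [volume_pi, lintegral_pi_fin_succ _ _ hgram, ← volume_pi,
      lintegral_congr fun w => lintegral_gramEntries_cons_eq hf w,
      lintegral_comp_sum_norm_sq k hslice, setLIntegral_posDefCone_succ hf, wishartConst,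
      Finset.prod_range_succ, ← wishartConst, mul_comm (wishartConst k),
      ENNReal.ofReal_mul (by positivity), mul_assoc,
      ← lintegral_const_mul' (ENNReal.ofReal (wishartConst k)) _ ENNReal.ofReal_ne_top]
    congr 1
    refine setLIntegral_congr_fun measurableSet_Ioi fun s hs => ?_
    have hs' : 0 < s := hs
    simp only [lintegral_gramEntries_cons_single hf hs'.le]
    rw [lintegral_congr fun u => ih (f := fun h => f (hermitianCons s (√s • star u)
        (entriesOfMatrix (vecMulVec u (star u)) + h))) (hf.comp (by fun_prop)),
      lintegral_const_mul' _ _ ENNReal.ofReal_ne_top,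
      lintegral_setLIntegral_posDefCone_hermitianCons hf hs', mul_left_comm,
      ← mul_assoc (ENNReal.ofReal (s ^ k)), ← ENNReal.ofReal_mul (by positivity),
      mul_inv_cancel₀ (by positivity), ENNReal.ofReal_one, one_mul]

end Wishart

section GaussApprox

theorem log_one_add_le {v : ℝ} (hv : -1 < v) :
    Real.log (1 + v) ≤ v - v ^ 2 / (2 * (1 + |v|)) := by
  rcases le_total 0 v with hv0 | hv0
  · have hpos : 0 < 1 + v := by linarith
    have hsinh := Real.self_le_sinh_iff.2 (Real.log_nonneg (by linarith : (1 : ℝ) ≤ 1 + v))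
    rw [Real.sinh_eq, Real.exp_log hpos, Real.exp_neg, Real.exp_log hpos] at hsinh
    rw [abs_of_nonneg hv0]
    refine hsinh.trans (le_of_eq ?_)
    field_simp
    ring
  · have hseries := Real.hasSum_pow_div_log_of_abs_lt_one (x := -v)
      (by rw [abs_neg, abs_of_nonpos hv0]; linarith)
    have htwo := sum_le_hasSum (Finset.range 2)
      (fun i _ => div_nonneg (pow_nonneg (neg_nonneg.2 hv0) _) (by positivity)) hseries
    norm_num [Finset.sum_range_succ] at htwo
    have hweaken : v ^ 2 / (2 * (1 + |v|)) ≤ v ^ 2 / 2 := by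
      gcongr
      linarith [abs_nonneg v]
    linarith

/-- `(1 + u / √N) ^ N * exp (-√N u)`, an approximation of `exp (-u ^ 2 / 2)`, set to zero where its
base is not positive. -/
def gaussApprox (N : ℕ) (u : ℝ) : ℝ :=
  if 0 < 1 + u / √N then (1 + u / √N) ^ N * Real.exp (-(√N * u)) else 0

theorem gaussApprox_nonneg (N : ℕ) (u : ℝ) : 0 ≤ gaussApprox N u := by
  unfold gaussApprox
  split_ifs <;> positivity

theorem gaussApprox_eq_exp {N : ℕ} {u : ℝ} (hu : 0 < 1 + u / √N) :
    gaussApprox N u = Real.exp (N * (Real.log (1 + u / √N) - u / √N)) := by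
  have hlinear : (N : ℝ) * (u / √N) = √N * u := by
    rw [mul_div_left_comm, Real.div_sqrt, mul_comm]
  rw [gaussApprox, if_pos hu, mul_sub, hlinear, sub_eq_add_neg, Real.exp_add, Real.exp_nat_mul,
    Real.exp_log hu]

theorem gaussApprox_le {N : ℕ} (hN : 0 < N) (u : ℝ) :
    gaussApprox N u ≤ Real.exp (1 / 2 - |u| / 2) := by
  by_cases hu : 0 < 1 + u / √N
  · rw [gaussApprox_eq_exp hu, Real.exp_le_exp]
    have hsqrt : 1 ≤ √(N : ℝ) := Real.one_le_sqrt.2 (by exact_mod_cast hN)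
    have habs : |u / √N| ≤ |u| := by
      rw [abs_div, abs_of_nonneg (Real.sqrt_nonneg _)]
      exact div_le_self (abs_nonneg u) hsqrt
    have hlog : Real.log (1 + u / √N) - u / √N ≤ -((u / √N) ^ 2 / (2 * (1 + |u|))) := by
      have hdenom : (u / √N) ^ 2 / (2 * (1 + |u|)) ≤ (u / √N) ^ 2 / (2 * (1 + |u / √N|)) := by
        gcongr
      linarith [log_one_add_le (v := u / √N) (by linarith)]
    have hquadratic : |u| / 2 - 1 / 2 ≤ u ^ 2 / (2 * (1 + |u|)) := by
      rw [le_div_iff₀ (by positivity), ← sq_abs]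
      nlinarith [abs_nonneg u]
    calc (N : ℝ) * (Real.log (1 + u / √N) - u / √N)
        ≤ N * -((u / √N) ^ 2 / (2 * (1 + |u|))) := by gcongr
      _ = -(u ^ 2 / (2 * (1 + |u|))) := by
          rw [div_pow, Real.sq_sqrt N.cast_nonneg]
          field_simp
      _ ≤ 1 / 2 - |u| / 2 := by linarith
  · rw [gaussApprox, if_neg hu]
    positivity

theorem tendsto_mul_log_one_add_div_sqrt_sub (u : ℝ) :
    Tendsto (fun N : ℕ => (N : ℝ) * (Real.log (1 + u / √N) - u / √N)) atTop (𝓝 (-u ^ 2 / 2)) := by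
  have hsqrt : Tendsto (fun N : ℕ => √(N : ℝ)) atTop atTop :=
    Real.tendsto_sqrt_atTop.comp tendsto_natCast_atTop_atTop
  have hbound : Tendsto (fun N : ℕ => 2 * |u| ^ 3 / √(N : ℝ)) atTop (𝓝 0) :=
    hsqrt.const_div_atTop _
  rw [tendsto_iff_norm_sub_tendsto_zero]
  refine squeeze_zero' (Eventually.of_forall fun _ => norm_nonneg _) ?_ hbound
  filter_upwards [hsqrt.eventually_ge_atTop (2 * |u| + 1)] with N hN
  have hpos : 0 < √(N : ℝ) := by linarith [abs_nonneg u]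
  have hsq : √(N : ℝ) ^ 2 = N := Real.sq_sqrt N.cast_nonneg
  have hlog := abs_log_one_add_sub_add_sq_div_two_le (t := u / √N) (by
    rw [abs_div, abs_of_pos hpos, div_le_iff₀ hpos]; linarith)
  have hfactor : (N : ℝ) * (Real.log (1 + u / √N) - u / √N) - -u ^ 2 / 2 =
      N * (Real.log (1 + u / √N) - u / √N + (u / √N) ^ 2 / 2) := by
    have hN0 : (N : ℝ) ≠ 0 := hsq ▸ (pow_pos hpos 2).ne'
    rw [mul_add, div_pow, hsq]
    field_simp
    ring
  rw [hfactor, Real.norm_eq_abs, abs_mul, Nat.abs_cast]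
  refine (mul_le_mul_of_nonneg_left hlog N.cast_nonneg).trans (le_of_eq ?_)
  rw [abs_div, abs_of_pos hpos]
  nth_rewrite 1 [← hsq]
  field_simp

theorem tendsto_gaussApprox (u : ℝ) :
    Tendsto (fun N : ℕ => gaussApprox N u) atTop (𝓝 (Real.exp (-u ^ 2 / 2))) := by
  refine ((Real.continuous_exp.tendsto _).comp
    (tendsto_mul_log_one_add_div_sqrt_sub u)).congr' ?_
  have hsqrt : Tendsto (fun N : ℕ => √(N : ℝ)) atTop atTop :=
    Real.tendsto_sqrt_atTop.comp tendsto_natCast_atTop_atTop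
  have hbase : Tendsto (fun N : ℕ => 1 + u / √N) atTop (𝓝 (1 + 0)) :=
    (hsqrt.const_div_atTop u).const_add 1
  filter_upwards [hbase.eventually_const_lt (by norm_num : (0 : ℝ) < 1 + 0)] with N hpos
  rw [Function.comp_apply, gaussApprox_eq_exp hpos]

end GaussApprox

section Spectral

open Matrix
open scoped ComplexOrder

variable {n 𝕜 : Type*} [Fintype n] [RCLike 𝕜] {A : Matrix n n 𝕜}

theorem trace_mul_self_eq_sum_norm_sq (hA : A.IsHermitian) :
    (A * A).trace = ((∑ i, ∑ j, ‖A i j‖ ^ 2 : ℝ) : 𝕜) := by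
  simp only [trace, diag_apply, Matrix.mul_apply, RCLike.ofReal_sum]
  refine Finset.sum_congr rfl fun i _ => Finset.sum_congr rfl fun j _ => ?_
  rw [← hA.apply j i, RCLike.star_def, RCLike.mul_conj, RCLike.ofReal_pow]

variable [DecidableEq n] (hA : A.IsHermitian)

theorem smul_one_add_smul_eq_conjStarAlgAut (a b : ℝ) :
    a • (1 : Matrix n n 𝕜) + b • A = Unitary.conjStarAlgAut 𝕜 _ hA.eigenvectorUnitary
      (diagonal fun i => ((a + b * hA.eigenvalues i : ℝ) : 𝕜)) := by
  have hdiag : (diagonal fun i => ((a + b * hA.eigenvalues i : ℝ) : 𝕜)) =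
      (a : 𝕜) • (1 : Matrix n n 𝕜) + (b : 𝕜) • diagonal (RCLike.ofReal ∘ hA.eigenvalues) := by
    rw [← diagonal_one, ← diagonal_smul, ← diagonal_smul, diagonal_add]
    simp
  rw [hdiag, map_add, map_smul, map_smul, map_one, ← hA.spectral_theorem, algebraMap_smul,
    algebraMap_smul]

theorem posDef_smul_one_add_smul_iff (a b : ℝ) :
    (a • (1 : Matrix n n 𝕜) + b • A).PosDef ↔ ∀ i, 0 < a + b * hA.eigenvalues i := by
  rw [smul_one_add_smul_eq_conjStarAlgAut hA, Unitary.conjStarAlgAut_apply,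
    Unitary.isUnit_coe.posDef_star_right_conjugate_iff, posDef_diagonal_iff]
  simp only [RCLike.ofReal_pos]

theorem det_smul_one_add_smul (a b : ℝ) :
    (a • (1 : Matrix n n 𝕜) + b • A).det = ((∏ i, (a + b * hA.eigenvalues i) : ℝ) : 𝕜) := by
  rw [smul_one_add_smul_eq_conjStarAlgAut hA, Unitary.conjStarAlgAut_apply, det_mul_right_comm,
    Unitary.mul_star_self_of_mem hA.eigenvectorUnitary.2, one_mul, det_diagonal, RCLike.ofReal_prod]

theorem trace_mul_self_eq_sum_eigenvalues_sq :
    (A * A).trace = ((∑ i, hA.eigenvalues i ^ 2 : ℝ) : 𝕜) := by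
  conv_lhs => rw [hA.spectral_theorem, ← map_mul, Unitary.conjStarAlgAut_apply]
  rw [trace_mul_comm, ← Matrix.mul_assoc, Unitary.star_mul_self_of_mem hA.eigenvectorUnitary.2,
    Matrix.one_mul, diagonal_mul_diagonal, trace_diagonal]
  simp [sq]

theorem norm_apply_le_sum_abs_eigenvalues (i j : n) : ‖A i j‖ ≤ ∑ i, |hA.eigenvalues i| := by
  have hsq : ∑ i, ∑ j, ‖A i j‖ ^ 2 = ∑ i, |hA.eigenvalues i| ^ 2 := by
    have htrace := (trace_mul_self_eq_sum_norm_sq hA).symm.trans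
      (trace_mul_self_eq_sum_eigenvalues_sq hA)
    simpa using RCLike.ofReal_injective htrace
  refine le_of_sq_le_sq ?_ (Finset.sum_nonneg fun _ _ => abs_nonneg _)
  calc ‖A i j‖ ^ 2 ≤ ∑ j, ‖A i j‖ ^ 2 :=
        Finset.single_le_sum (f := fun j => ‖A i j‖ ^ 2) (fun _ _ => by positivity)
          (Finset.mem_univ j)
    _ ≤ ∑ i, ∑ j, ‖A i j‖ ^ 2 :=
        Finset.single_le_sum (f := fun i => ∑ j, ‖A i j‖ ^ 2) (fun _ _ => by positivity)
          (Finset.mem_univ i)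
    _ = ∑ i, |hA.eigenvalues i| ^ 2 := hsq
    _ ≤ (∑ i, |hA.eigenvalues i|) ^ 2 := Finset.sum_sq_le_sq_sum_of_nonneg fun _ _ => abs_nonneg _

end Spectral

section UpperPairs

theorem sum_sum_eq_sum_diag_add_two_nsmul {M : Type*} [AddCommMonoid M] :
    ∀ {k : ℕ} (f : Fin k → Fin k → M), (∀ i j, f i j = f j i) →
      ∑ i, ∑ j, f i j = ∑ i, f i i + 2 • ∑ p : {p : Fin k × Fin k // p.1 < p.2}, f p.1.1 p.1.2
  | 0, _, _ => by simp
  | k + 1, f, hf => by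
    have hblock := sum_sum_eq_sum_diag_add_two_nsmul (fun i j => f (Fin.succ i) (Fin.succ j))
      fun i j => hf _ _
    rw [← (upperPairsSuccEquiv k).sum_comp, Fintype.sum_sum_type,
      Fin.sum_univ_succ (fun i => f i i)]
    simp only [Fin.sum_univ_succ, Finset.sum_add_distrib, hblock, hf (Fin.succ _) 0,
      upperPairsSuccEquiv, Equiv.coe_fn_mk, Sum.elim_inl, Sum.elim_inr]
    abel

theorem add_two_mul_card_upperPairs (k : ℕ) :
    k + 2 * Fintype.card {p : Fin k × Fin k // p.1 < p.2} = k * k := by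
  simpa using
    (sum_sum_eq_sum_diag_add_two_nsmul (fun _ _ : Fin k => (1 : ℕ)) fun _ _ => rfl).symm

theorem finrank_hermitianEntries (k : ℕ) : Module.finrank ℝ (HermitianEntries k) = k * k := by
  rw [Module.finrank_prod, Module.finrank_fintype_fun_eq_card, Module.finrank_pi_fintype]
  simp only [Complex.finrank_real_complex, Finset.sum_const, Finset.card_univ, Fintype.card_fin,
    smul_eq_mul]
  rw [mul_comm _ 2, add_two_mul_card_upperPairs]

end UpperPairs

section Gue

open Matrix
open scoped ComplexOrder

variable {k : ℕ}

/-- The coordinates of the `k × k` identity matrix. -/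
def identityEntries (k : ℕ) : HermitianEntries k := (1, 0)

theorem hermitianOfEntries_smul_identityEntries_add_smul (a b : ℝ) (h : HermitianEntries k) :
    hermitianOfEntries (a • identityEntries k + b • h) =
      a • (1 : Matrix (Fin k) (Fin k) ℂ) + b • hermitianOfEntries h := by
  have hone : hermitianOfEntries (identityEntries k) = 1 := by
    ext i j
    rcases lt_trichotomy i j with hij | rfl | hij
    · simp [hermitianOfEntries, identityEntries, hij, hij.ne]
    · simp [hermitianOfEntries, identityEntries]
    · simp [hermitianOfEntries, identityEntries, hij, hij.not_gt, hij.ne']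
  rw [hermitianOfEntries_add, hermitianOfEntries_smul, hermitianOfEntries_smul, hone]

theorem smul_identityEntries_add_smul_mem_posDefCone_iff (a b : ℝ) (h : HermitianEntries k) :
    a • identityEntries k + b • h ∈ posDefCone k ↔
      ∀ i, 0 < a + b * (isHermitian_hermitianOfEntries h).eigenvalues i := by
  rw [posDefCone, Set.mem_ofPred_eq, hermitianOfEntries_smul_identityEntries_add_smul,
    posDef_smul_one_add_smul_iff (isHermitian_hermitianOfEntries h)]

/-- The Hermitian matrices whose eigenvalues are all larger than `-x`. -/
def shiftedCone (k : ℕ) (x : ℝ) : Set (HermitianEntries k) :=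
  {h | x • identityEntries k + h ∈ posDefCone k}

theorem mem_shiftedCone_iff {x : ℝ} {h : HermitianEntries k} : h ∈ shiftedCone k x ↔
    ∀ i, 0 < x + (isHermitian_hermitianOfEntries h).eigenvalues i := by
  simpa only [one_smul, one_mul] using! smul_identityEntries_add_smul_mem_posDefCone_iff x 1 h

theorem neg_mem_shiftedCone_iff {x : ℝ} {h : HermitianEntries k} : -h ∈ shiftedCone k x ↔
    ∀ i, (isHermitian_hermitianOfEntries h).eigenvalues i < x := by
  simpa only [neg_smul, one_smul, neg_mul, one_mul, ← sub_eq_add_neg, sub_pos] using!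
    smul_identityEntries_add_smul_mem_posDefCone_iff x (-1) h

theorem shiftedCone_mono {x y : ℝ} (hxy : x ≤ y) : shiftedCone k x ⊆ shiftedCone k y :=
  fun _ hh => mem_shiftedCone_iff.2 fun i =>
    (mem_shiftedCone_iff.1 hh i).trans_le (add_le_add_left hxy _)

theorem measurableSet_shiftedCone (x : ℝ) : MeasurableSet (shiftedCone k x) :=
  measurable_const_add _ (measurableSet_posDefCone k)

theorem volume_shiftedCone_ne_zero (x : ℝ) : volume (shiftedCone k x) ≠ 0 := by
  have hcone : volume (shiftedCone k x) = volume (posDefCone k) := measure_preimage_add _ _ _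
  intro hzero
  have huniv := lintegral_gramEntries k (f := fun _ => 1) measurable_const
  rw [setLIntegral_one, ← hcone, hzero, mul_zero, lintegral_one] at huniv
  simp [volume_pi, Measure.pi_univ] at huniv

/-- The unnormalized density of the GUE. -/
def gueDensity (h : HermitianEntries k) : ℝ :=
  Real.exp (-(hermitianOfEntries h * hermitianOfEntries h).trace.re / 2)

theorem gueDensity_pos (h : HermitianEntries k) : 0 < gueDensity h := Real.exp_pos _

theorem gueDensity_neg (h : HermitianEntries k) : gueDensity (-h) = gueDensity h := by
  rw [gueDensity, gueDensity, ← neg_one_smul ℝ h, hermitianOfEntries_smul, neg_one_smul,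
    neg_mul_neg]

@[fun_prop]
theorem measurable_gueDensity : Measurable (gueDensity (k := k)) := by
  unfold gueDensity
  exact Continuous.measurable (by fun_prop)

theorem gueDensity_eq_prod_eigenvalues (h : HermitianEntries k) : gueDensity h =
    ∏ i, Real.exp (-(isHermitian_hermitianOfEntries h).eigenvalues i ^ 2 / 2) := by
  rw [gueDensity, trace_mul_self_eq_sum_eigenvalues_sq (isHermitian_hermitianOfEntries h),
    RCLike.ofReal_eq_complex_ofReal, Complex.ofReal_re, ← Real.exp_sum, ← Finset.sum_neg_distrib,
    Finset.sum_div]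

theorem gueDensity_eq_prod_entries (h : HermitianEntries k) : gueDensity h =
    (∏ i, Real.exp (-(1 / 2) * h.1 i ^ 2)) * ∏ p, Real.exp (-‖h.2 p‖ ^ 2) := by
  rw [gueDensity, trace_mul_self_eq_sum_norm_sq (isHermitian_hermitianOfEntries h),
    RCLike.ofReal_eq_complex_ofReal, Complex.ofReal_re, sum_sum_eq_sum_diag_add_two_nsmul _
      fun i j => by rw [← (isHermitian_hermitianOfEntries h).apply i j, norm_star],
    ← Real.exp_sum, ← Real.exp_sum, ← Real.exp_add]
  have hoffDiag : ∀ p : {p : Fin k × Fin k // p.1 < p.2},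
      hermitianOfEntries h p.1.1 p.1.2 = h.2 p := fun p => dif_pos p.2
  have hdiag : ∀ i, hermitianOfEntries h i i = h.1 i := fun i => by simp [hermitianOfEntries]
  simp only [hoffDiag, hdiag, Complex.norm_real, Real.norm_eq_abs, sq_abs, Finset.sum_neg_distrib,
    ← Finset.mul_sum, two_nsmul]
  congr 1
  ring

theorem integral_gueDensity (k : ℕ) : ∫ h : HermitianEntries k, gueDensity h =
    √(2 * Real.pi) ^ k * Real.pi ^ Fintype.card {p : Fin k × Fin k // p.1 < p.2} := by
  have hcomplex : ∫ w : ℂ, Real.exp (-‖w‖ ^ 2) = Real.pi := by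
    simpa using integral_norm_pow_mul_exp_neg_sq 0
  simp_rw [gueDensity_eq_prod_entries]
  rw [Measure.volume_eq_prod,
    integral_prod_mul (fun d : Fin k → ℝ => ∏ i, Real.exp (-(1 / 2) * d i ^ 2))
    (fun u : {p : Fin k × Fin k // p.1 < p.2} → ℂ => ∏ p, Real.exp (-‖u p‖ ^ 2)),
    integral_fintype_prod_volume_eq_pow (fun t : ℝ => Real.exp (-(1 / 2) * t ^ 2)),
    integral_fintype_prod_volume_eq_pow (fun w : ℂ => Real.exp (-‖w‖ ^ 2)), hcomplex,
    integral_gaussian, Fintype.card_fin, div_div_eq_mul_div, div_one, mul_comm Real.pi]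

/-- The product of `gaussApprox N` over the eigenvalues. -/
def gaussApproxDet (N : ℕ) (h : HermitianEntries k) : ℝ :=
  ∏ i, gaussApprox N ((isHermitian_hermitianOfEntries h).eigenvalues i)

theorem gaussApproxDet_nonneg (N : ℕ) (h : HermitianEntries k) : 0 ≤ gaussApproxDet N h :=
  Finset.prod_nonneg fun _ _ => gaussApprox_nonneg _ _

theorem tendsto_gaussApproxDet (h : HermitianEntries k) :
    Tendsto (fun N : ℕ => gaussApproxDet N h) atTop (𝓝 (gueDensity h)) := by
  rw [gueDensity_eq_prod_eigenvalues]
  exact tendsto_finsetProd _ fun i _ => tendsto_gaussApprox _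

theorem gaussApproxDet_eq_of_mem {N : ℕ} {h : HermitianEntries k}
    (hh : (1 : ℝ) • identityEntries k + (√N)⁻¹ • h ∈ posDefCone k) :
    (gaussApproxDet N h : ℂ) = ((1 : ℝ) • (1 : Matrix (Fin k) (Fin k) ℂ) +
      (√N)⁻¹ • hermitianOfEntries h).det ^ N *
        Real.exp (-(√N * (hermitianOfEntries h).trace.re)) := by
  have hH := isHermitian_hermitianOfEntries h
  rw [smul_identityEntries_add_smul_mem_posDefCone_iff] at hh
  rw [det_smul_one_add_smul hH, hH.trace_eq_sum_eigenvalues, gaussApproxDet]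
  simp only [RCLike.ofReal_eq_complex_ofReal]
  rw [← Complex.ofReal_sum, Complex.ofReal_re, Finset.mul_sum, ← Finset.sum_neg_distrib,
    Real.exp_sum, ← Complex.ofReal_pow, ← Complex.ofReal_mul, ← Finset.prod_pow,
    ← Finset.prod_mul_distrib]
  simp only [gaussApprox, div_eq_inv_mul, hh, if_true]

theorem gaussApproxDet_eq_zero_of_notMem {N : ℕ} {h : HermitianEntries k}
    (hh : (1 : ℝ) • identityEntries k + (√N)⁻¹ • h ∉ posDefCone k) : gaussApproxDet N h = 0 := by
  rw [smul_identityEntries_add_smul_mem_posDefCone_iff] at hh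
  push Not at hh
  obtain ⟨i, hi⟩ := hh
  refine Finset.prod_eq_zero (Finset.mem_univ i) ?_
  rw [gaussApprox, div_eq_inv_mul, if_neg (not_lt.2 hi)]

@[fun_prop]
theorem measurable_gaussApproxDet (N : ℕ) : Measurable (gaussApproxDet (k := k) N) := by
  classical
  have hcone : MeasurableSet
      {h : HermitianEntries k | (1 : ℝ) • identityEntries k + (√N)⁻¹ • h ∈ posDefCone k} :=
    measurableSet_preimage (by fun_prop) (measurableSet_posDefCone k)
  have hdet : Measurable fun h : HermitianEntries k =>
      (((1 : ℝ) • (1 : Matrix (Fin k) (Fin k) ℂ) + (√N)⁻¹ • hermitianOfEntries h).det ^ N *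
        Real.exp (-(√N * (hermitianOfEntries h).trace.re))).re :=
    Continuous.measurable (by fun_prop)
  convert hdet.indicator hcone using 1
  ext h
  by_cases hh : (1 : ℝ) • identityEntries k + (√N)⁻¹ • h ∈ posDefCone k
  · rw [Set.indicator_of_mem (by exact hh), ← gaussApproxDet_eq_of_mem hh, Complex.ofReal_re]
  · rw [Set.indicator_of_notMem (by exact hh), gaussApproxDet_eq_zero_of_notMem hh]

theorem norm_le_sum_abs_eigenvalues (h : HermitianEntries k) :
    ‖h‖ ≤ ∑ i, |(isHermitian_hermitianOfEntries h).eigenvalues i| := by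
  have hentry := norm_apply_le_sum_abs_eigenvalues (isHermitian_hermitianOfEntries h)
  have hnonneg : 0 ≤ ∑ i, |(isHermitian_hermitianOfEntries h).eigenvalues i| :=
    Finset.sum_nonneg fun _ _ => abs_nonneg _
  rw [Prod.norm_def, max_le_iff, pi_norm_le_iff_of_nonneg hnonneg, pi_norm_le_iff_of_nonneg hnonneg]
  exact ⟨fun i => by simpa [hermitianOfEntries] using hentry i i,
    fun p => by simpa [hermitianOfEntries, p.2] using hentry p.1.1 p.1.2⟩

theorem gaussApproxDet_le {N : ℕ} (hN : 0 < N) (h : HermitianEntries k) :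
    gaussApproxDet N h ≤ Real.exp (k / 2 - ‖h‖ / 2) := by
  calc gaussApproxDet N h
      ≤ ∏ i, Real.exp (1 / 2 - |(isHermitian_hermitianOfEntries h).eigenvalues i| / 2) :=
        Finset.prod_le_prod (fun _ _ => gaussApprox_nonneg _ _) fun _ _ => gaussApprox_le hN _
    _ = Real.exp (k / 2 - (∑ i, |(isHermitian_hermitianOfEntries h).eigenvalues i|) / 2) := by
        simp [← Real.exp_sum, Finset.sum_sub_distrib, Finset.sum_mul, div_eq_mul_inv]
    _ ≤ Real.exp (k / 2 - ‖h‖ / 2) := by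
        gcongr
        exact norm_le_sum_abs_eigenvalues h

theorem gueDensity_le (h : HermitianEntries k) : gueDensity h ≤ Real.exp (k / 2 - ‖h‖ / 2) :=
  le_of_tendsto (tendsto_gaussApproxDet h)
    ((eventually_gt_atTop 0).mono fun _ hN => gaussApproxDet_le hN h)

theorem integrable_exp_sub_half_norm {E : Type*} [NormedAddCommGroup E] [NormedSpace ℝ E]
    [FiniteDimensional ℝ E] [MeasurableSpace E] [BorelSpace E] (μ : Measure E)
    [μ.IsAddHaarMeasure] (a : ℝ) : Integrable (fun x : E => Real.exp (a - ‖x‖ / 2)) μ := by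
  set m := Module.finrank ℝ E + 1
  have hpow := integrable_one_add_norm (μ := μ) (E := E) (r := (m : ℝ)) (by simp [m])
  refine (hpow.const_mul (Real.exp (a + 1 / 2) * (m.factorial * 2 ^ m))).mono'
    (Measurable.aestronglyMeasurable (by fun_prop)) (ae_of_all _ fun x => ?_)
  have hexp := Real.pow_div_factorial_le_exp (x := (1 + ‖x‖) / 2) (by positivity) m
  rw [div_pow, div_div, div_le_iff₀ (by positivity)] at hexp
  rw [Real.norm_of_nonneg (Real.exp_pos _).le, Real.rpow_neg (by positivity), Real.rpow_natCast,
    ← div_eq_mul_inv, le_div_iff₀ (by positivity)]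
  calc Real.exp (a - ‖x‖ / 2) * (1 + ‖x‖) ^ m
      ≤ Real.exp (a - ‖x‖ / 2) * (Real.exp ((1 + ‖x‖) / 2) * (2 ^ m * m.factorial)) := by gcongr
    _ = Real.exp (a + 1 / 2) * (m.factorial * 2 ^ m) := by
      rw [← mul_assoc, ← Real.exp_add]
      ring_nf

theorem integrable_gaussApproxDet {N : ℕ} (hN : 0 < N) : Integrable (gaussApproxDet (k := k) N) :=
  (integrable_exp_sub_half_norm volume (k / 2)).mono'
    (measurable_gaussApproxDet N).aestronglyMeasurable (ae_of_all _ fun h => by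
      rw [Real.norm_of_nonneg (gaussApproxDet_nonneg _ _)]
      exact gaussApproxDet_le hN h)

theorem integrable_gueDensity : Integrable (gueDensity (k := k)) :=
  (integrable_exp_sub_half_norm volume (k / 2)).mono'
    measurable_gueDensity.aestronglyMeasurable (ae_of_all _ fun h => by
      rw [Real.norm_of_nonneg (gueDensity_pos h).le]
      exact gueDensity_le h)

theorem tendsto_integral_abs_gaussApproxDet_sub (k : ℕ) :
    Tendsto (fun N : ℕ => ∫ h : HermitianEntries k, |gaussApproxDet N h - gueDensity h|) atTop
      (𝓝 0) := by
  rw [← integral_zero (HermitianEntries k) ℝ]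
  refine tendsto_integral_filter_of_dominated_convergence
    (fun h => Real.exp (k / 2 - ‖h‖ / 2))
    (Eventually.of_forall fun N => Measurable.aestronglyMeasurable (by fun_prop)) ?_
    (integrable_exp_sub_half_norm volume (k / 2)) (ae_of_all _ fun h => ?_)
  · filter_upwards [eventually_gt_atTop 0] with N hN
    refine ae_of_all _ fun h => ?_
    rw [Real.norm_eq_abs, abs_abs]
    exact abs_sub_le_of_nonneg_of_le (gaussApproxDet_nonneg N h) (gaussApproxDet_le hN h)
      (gueDensity_pos h).le (gueDensity_le h)
  · simpa using ((tendsto_gaussApproxDet h).sub_const (gueDensity h)).abs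

theorem setIntegral_gueDensity_pos (x : ℝ) : 0 < ∫ h in shiftedCone k x, gueDensity h := by
  rw [setIntegral_pos_iff_support_of_nonneg_ae (ae_of_all _ fun h => (gueDensity_pos h).le)
    integrable_gueDensity.integrableOn,
    Function.support_eq_univ fun h => (gueDensity_pos h).ne', Set.univ_inter]
  exact pos_iff_ne_zero.2 (volume_shiftedCone_ne_zero x)

theorem largestEigenvalue_lt_iff {h : HermitianEntries k} {x : ℝ} :
    largestEigenvalue h < (x : EReal) ↔ -h ∈ shiftedCone k x := by
  rw [neg_mem_shiftedCone_iff, largestEigenvalue]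
  rcases isEmpty_or_nonempty (Fin k) with hk | hk
  · simp [EReal.bot_lt_coe]
  · rw [← Finset.sup'_univ_eq_ciSup, Finset.sup'_lt_iff]
    simp

theorem gueWeight_real_neg_mem {s : Set (HermitianEntries k)} (hs : MeasurableSet s) :
    (gueWeight k).real {h | -h ∈ s} = ∫ h in s, gueDensity h := by
  have hneg : MeasurePreserving (fun h : HermitianEntries k => -h) :=
    (Measure.measurePreserving_neg volume).prod (Measure.measurePreserving_neg volume)
  have hweight : gueWeight k ((fun h => -h) ⁻¹' s) = ENNReal.ofReal (∫ h in s, gueDensity h) := by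
    rw [gueWeight, withDensity_apply _ (hneg.measurable hs), ofReal_integral_eq_lintegral_ofReal
      integrable_gueDensity.integrableOn (ae_of_all _ fun h => (gueDensity_pos h).le),
      ← hneg.setLIntegral_comp_preimage hs (by fun_prop)]
    simp only [gueDensity_neg]
    rfl
  rw [measureReal_def, ← Set.preimage_ofPred_eq, Set.ofPred_mem_eq, hweight,
    ENNReal.toReal_ofReal (integral_nonneg fun h => (gueDensity_pos h).le)]

theorem gueMaxCDF_eq (k : ℕ) (x : ℝ) : gueMaxCDF k x =
    (∫ h in shiftedCone k x, gueDensity h) / ∫ h : HermitianEntries k, gueDensity h := by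
  have htotal : (gueWeight k).real Set.univ = ∫ h : HermitianEntries k, gueDensity h := by
    simpa using gueWeight_real_neg_mem (k := k) MeasurableSet.univ
  rw [gueMaxCDF, gueLaw, measureReal_ennreal_smul_apply, ENNReal.toReal_inv, ← measureReal_def,
    htotal, ← gueWeight_real_neg_mem (measurableSet_shiftedCone x), div_eq_inv_mul]
  simp only [largestEigenvalue_lt_iff]

end Gue

section Asymptotics

open Matrix
open scoped ComplexOrder

variable {k : ℕ}

theorem prod_complexNormalPDF_eq (W : Fin k → Fin k → ℂ) :
    ∏ i, ∏ j, complexNormalPDF (W i j) = ENNReal.ofReal ((Real.pi ^ (k * k))⁻¹ *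
      Real.exp (-(hermitianOfEntries (gramEntries W)).trace.re)) := by
  have htrace : (hermitianOfEntries (gramEntries W)).trace.re = ∑ i, ∑ j, ‖W i j‖ ^ 2 := by
    simp [hermitianOfEntries_gramEntries, trace, Matrix.mul_apply, Complex.mul_conj,
      Complex.normSq_eq_norm_sq, -Complex.ofReal_pow]
  have hrow (i : Fin k) : ∏ j, complexNormalPDF (W i j) =
      ENNReal.ofReal (∏ j, Real.pi⁻¹ * Real.exp (-‖W i j‖ ^ 2)) :=
    (ENNReal.ofReal_prod_of_nonneg fun _ _ => by positivity).symm
  rw [htrace, Finset.prod_congr rfl fun i _ => hrow i,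
    ← ENNReal.ofReal_prod_of_nonneg fun _ _ => by positivity]
  simp only [Finset.prod_mul_distrib, ← Real.exp_sum, Finset.sum_neg_distrib, Finset.prod_const,
    Finset.card_univ, Fintype.card_fin, inv_pow, ← pow_mul]

theorem map_gramEntries_iidComplexNormal (k : ℕ) : (iidComplexNormal k).map gramEntries =
    ENNReal.ofReal (wishartConst k * (Real.pi ^ (k * k))⁻¹) •
      (volume.restrict (posDefCone k)).withDensity fun h =>
        ENNReal.ofReal (Real.exp (-(hermitianOfEntries h).trace.re)) := by
  set g : HermitianEntries k → ℝ≥0∞ := fun h =>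
    ENNReal.ofReal (Real.exp (-(hermitianOfEntries h).trace.re)) with hg
  have hgmeas : Measurable g := (Continuous.measurable (by fun_prop)).ennreal_ofReal
  refine Measure.ext_of_lintegral _ fun f hf => ?_
  calc ∫⁻ h, f h ∂(iidComplexNormal k).map gramEntries
      = ∫⁻ W, ENNReal.ofReal (Real.pi ^ (k * k))⁻¹ * (g * f) (gramEntries W) := by
        rw [lintegral_map hf measurable_gramEntries, iidComplexNormal_eq_withDensity,
          lintegral_withDensity_eq_lintegral_mul _ (by fun_prop) (by fun_prop)]
        simp only [Pi.mul_apply, prod_complexNormalPDF_eq, hg, mul_assoc,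
          ENNReal.ofReal_mul (inv_nonneg.2 (pow_nonneg Real.pi_pos.le (k * k)))]
    _ = ENNReal.ofReal (wishartConst k * (Real.pi ^ (k * k))⁻¹) *
          ∫⁻ h in posDefCone k, (g * f) h := by
        rw [lintegral_const_mul _ (by fun_prop), lintegral_gramEntries k (hgmeas.mul hf),
          ENNReal.ofReal_mul (wishartConst_pos k).le, mul_left_comm, mul_assoc]
    _ = _ := by
        rw [lintegral_smul_measure, lintegral_withDensity_eq_lintegral_mul _ hgmeas hf,
          smul_eq_mul]

theorem integral_iidComplexNormal_gramEntries {E : Type*} [NormedAddCommGroup E] [NormedSpace ℝ E]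
    {F : HermitianEntries k → E} (hF : StronglyMeasurable F) :
    ∫ W, F (gramEntries W) ∂iidComplexNormal k =
      (wishartConst k * (Real.pi ^ (k * k))⁻¹) •
        ∫ h in posDefCone k, Real.exp (-(hermitianOfEntries h).trace.re) • F h := by
  have hconst : 0 ≤ wishartConst k * (Real.pi ^ (k * k))⁻¹ :=
    mul_nonneg (wishartConst_pos k).le (by positivity)
  have hdensity : Measurable fun h : HermitianEntries k =>
      ENNReal.ofReal (Real.exp (-(hermitianOfEntries h).trace.re)) :=
    (Continuous.measurable (by fun_prop)).ennreal_ofReal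
  rw [← integral_map measurable_gramEntries.aemeasurable hF.aestronglyMeasurable,
    map_gramEntries_iidComplexNormal, integral_smul_measure, ENNReal.toReal_ofReal hconst,
    integral_withDensity_eq_integral_toReal_smul hdensity
      (ae_of_all _ fun _ => ENNReal.ofReal_lt_top)]
  simp only [ENNReal.toReal_ofReal (Real.exp_pos _).le]

theorem ginibreMoment_eq_integral (N k : ℕ) (z : ℂ) : (ginibreMoment N k z : ℂ) =
    ∫ W, (‖z‖ ^ 2 • (1 : Matrix (Fin k) (Fin k) ℂ) +
      (√N)⁻¹ ^ 2 • hermitianOfEntries (gramEntries W)).det ^ N ∂iidComplexNormal k := by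
  simp only [hermitianOfEntries_gramEntries]
  rw [← integral_norm_det_pow_eq N k (√N)⁻¹ z]
  simp only [ginibreMoment, ginibreMatrix, Complex.ofReal_inv]

theorem wishartConst_mul_integral_gueDensity (k : ℕ) :
    wishartConst k * (Real.pi ^ (k * k))⁻¹ * ∫ h : HermitianEntries k, gueDensity h =
      (2 * Real.pi) ^ ((k : ℝ) / 2) / barnesG (1 + k) := by
  have hsqrt : ((2 * Real.pi) ^ ((k : ℝ) / 2) : ℝ) = √(2 * Real.pi) ^ k := by
    rw [Real.sqrt_eq_rpow, ← Real.rpow_mul_natCast (by positivity)]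
    ring_nf
  have hpi : (∏ j ∈ Finset.range k, Real.pi ^ (j + 1)) *
      Real.pi ^ Fintype.card {p : Fin k × Fin k // p.1 < p.2} = Real.pi ^ (k * k) := by
    have hgauss : ∑ j ∈ Finset.range k, (j + 1) * 2 = k * k + k := by
      rw [← Finset.sum_mul, Finset.sum_add_distrib, add_mul, Finset.sum_range_id_mul_two]
      cases k <;> simp; ring
    rw [Finset.prod_pow_eq_pow_sum, ← pow_add]
    congr 1
    rw [← Finset.sum_mul] at hgauss
    linarith [add_two_mul_card_upperPairs k]
  rw [hsqrt, barnesG_one_add_natCast, integral_gueDensity, wishartConst, Finset.prod_div_distrib,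
    ← hpi]
  have hfactorial : (∏ j ∈ Finset.range k, (j.factorial : ℝ)) ≠ 0 :=
    Finset.prod_ne_zero_iff.2 fun j _ => by positivity
  have hpow : (∏ j ∈ Finset.range k, Real.pi ^ (j + 1)) ≠ 0 :=
    Finset.prod_ne_zero_iff.2 fun j _ => by positivity
  field_simp

theorem exp_half_sq_mul_log {N : ℕ} (hN : 0 < N) (k : ℕ) :
    Real.exp ((k : ℝ) ^ 2 / 2 * Real.log N) = √N ^ (k * k) := by
  have hN' : (0 : ℝ) < N := by exact_mod_cast hN
  rw [Real.sqrt_eq_rpow, ← Real.rpow_mul_natCast hN'.le, Real.rpow_def_of_pos hN']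
  push_cast
  ring_nf

theorem smul_identityEntries_add_smul_mem_posDefCone_iff_mem_shiftedCone {r : ℝ} (hr : 0 < r)
    {x : ℝ} {h : HermitianEntries k} :
    (r * x) • identityEntries k + r • h ∈ posDefCone k ↔ h ∈ shiftedCone k x := by
  simp only [smul_identityEntries_add_smul_mem_posDefCone_iff, mem_shiftedCone_iff, ← mul_add,
    mul_pos_iff_of_pos_left hr]

theorem setIntegral_posDefCone_eq_pow_smul {E : Type*} [NormedAddCommGroup E] [NormedSpace ℝ E]
    (F : HermitianEntries k → E) {r : ℝ} (hr : 0 < r) (x : ℝ) :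
    ∫ h in posDefCone k, F h =
      r ^ (k * k) • ∫ h in shiftedCone k x, F ((r * x) • identityEntries k + r • h) := by
  have hcone (h : HermitianEntries k) :
      (shiftedCone k x).indicator (fun h => F ((r * x) • identityEntries k + r • h)) h =
        (posDefCone k).indicator F ((r * x) • identityEntries k + r • h) := by
    classical
    simp only [Set.indicator_apply,
      smul_identityEntries_add_smul_mem_posDefCone_iff_mem_shiftedCone hr]
  rw [← integral_indicator (measurableSet_posDefCone k),
    ← integral_indicator (measurableSet_shiftedCone x), integral_congr_ae (ae_of_all _ hcone),
    Measure.integral_comp_smul volume fun h =>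
      (posDefCone k).indicator F ((r * x) • identityEntries k + h),
    finrank_hermitianEntries, integral_add_left_eq_self, abs_of_pos (by positivity),
    smul_inv_smul₀ (by positivity)]

theorem exp_neg_trace_smul_det_pow_eq {N : ℕ} (hN : 0 < N) {t : ℝ} (ht : 0 ≤ t)
    {h : HermitianEntries k} (hh : h ∈ shiftedCone k (√N * (1 - t))) :
    Real.exp (-(hermitianOfEntries
        ((√N * (√N * (1 - t))) • identityEntries k + √N • h)).trace.re) •
      (t • (1 : Matrix (Fin k) (Fin k) ℂ) + (√N)⁻¹ ^ 2 • hermitianOfEntries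
        ((√N * (√N * (1 - t))) • identityEntries k + √N • h)).det ^ N =
    ((Real.exp (N * k * (t - 1)) * gaussApproxDet N h : ℝ) : ℂ) := by
  have hR : 0 < √(N : ℝ) := Real.sqrt_pos.2 (by exact_mod_cast hN)
  have hmem : (1 : ℝ) • identityEntries k + (√N)⁻¹ • h ∈ posDefCone k := by
    rw [← inv_mul_cancel₀ hR.ne',
      smul_identityEntries_add_smul_mem_posDefCone_iff_mem_shiftedCone (inv_pos.2 hR)]
    exact shiftedCone_mono (mul_le_of_le_one_right hR.le (sub_le_self 1 ht)) hh
  have hmatrix : t • (1 : Matrix (Fin k) (Fin k) ℂ) + (√N)⁻¹ ^ 2 •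
      ((√N * (√N * (1 - t))) • (1 : Matrix (Fin k) (Fin k) ℂ) + √N • hermitianOfEntries h) =
      (1 : ℝ) • 1 + (√N)⁻¹ • hermitianOfEntries h := by
    match_scalars
    · field_simp
      ring
    · field_simp
  have htrace : ((√N * (√N * (1 - t))) • (1 : Matrix (Fin k) (Fin k) ℂ) +
      √N • hermitianOfEntries h).trace.re =
      -(N * k * (t - 1)) + √N * (hermitianOfEntries h).trace.re := by
    rw [trace_add, trace_smul, trace_smul, trace_one, Complex.add_re, Complex.smul_re,
      Complex.smul_re, Fintype.card_fin, Complex.natCast_re, ← mul_assoc, Real.mul_self_sqrt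
      N.cast_nonneg, smul_eq_mul, smul_eq_mul]
    ring
  rw [hermitianOfEntries_smul_identityEntries_add_smul, hmatrix, htrace, neg_add, neg_neg,
    Real.exp_add, Complex.real_smul]
  push_cast [gaussApproxDet_eq_of_mem hmem]
  ring

theorem ginibreMoment_eq {N : ℕ} (hN : 0 < N) (k : ℕ) (z : ℂ) : ginibreMoment N k z =
    wishartConst k * (Real.pi ^ (k * k))⁻¹ * (√N ^ (k * k) * (Real.exp (N * k * (‖z‖ ^ 2 - 1)) *
      ∫ h in shiftedCone k (√N * (1 - ‖z‖ ^ 2)), gaussApproxDet N h)) := by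
  have hR : 0 < √(N : ℝ) := Real.sqrt_pos.2 (by exact_mod_cast hN)
  have hmeas : StronglyMeasurable fun h : HermitianEntries k =>
      (‖z‖ ^ 2 • (1 : Matrix (Fin k) (Fin k) ℂ) +
        (√N)⁻¹ ^ 2 • hermitianOfEntries h).det ^ N :=
    Continuous.stronglyMeasurable (by fun_prop)
  rw [← Complex.ofReal_inj, ginibreMoment_eq_integral, integral_iidComplexNormal_gramEntries hmeas,
    setIntegral_posDefCone_eq_pow_smul _ hR (√N * (1 - ‖z‖ ^ 2)),
    setIntegral_congr_fun (measurableSet_shiftedCone _) fun h hh =>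
      exp_neg_trace_smul_det_pow_eq hN (sq_nonneg ‖z‖) hh,
    integral_complex_ofReal, integral_const_mul, Complex.real_smul, Complex.real_smul]
  simp only [Complex.ofReal_mul]

theorem ginibreMoment_eq_mul {N : ℕ} (hN : 0 < N) (k : ℕ) (z : ℂ) : ginibreMoment N k z =
    Real.exp ((N : ℝ) * k * (‖z‖ ^ 2 - 1) + (k : ℝ) ^ 2 / 2 * Real.log N) *
      ((2 * Real.pi) ^ ((k : ℝ) / 2) / barnesG (1 + k)) *
      gueMaxCDF k (√N * (1 - ‖z‖ ^ 2)) *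
      ((∫ h in shiftedCone k (√N * (1 - ‖z‖ ^ 2)), gaussApproxDet N h) /
        ∫ h in shiftedCone k (√N * (1 - ‖z‖ ^ 2)), gueDensity h) := by
  have hcone := (setIntegral_gueDensity_pos (k := k) (√N * (1 - ‖z‖ ^ 2))).ne'
  have htotal : (∫ h : HermitianEntries k, gueDensity h) ≠ 0 :=
    (integral_gueDensity k).trans_ne (by positivity)
  rw [ginibreMoment_eq hN, gueMaxCDF_eq, Real.exp_add, exp_half_sq_mul_log hN,
    ← wishartConst_mul_integral_gueDensity]
  field_simp

theorem abs_setIntegral_div_sub_one_le {N : ℕ} (hN : 0 < N) {x y : ℝ} (hxy : x ≤ y) :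
    |(∫ h in shiftedCone k y, gaussApproxDet N h) / (∫ h in shiftedCone k y, gueDensity h) - 1| ≤
      (∫ h : HermitianEntries k, |gaussApproxDet N h - gueDensity h|) /
        ∫ h in shiftedCone k x, gueDensity h := by
  have hx := setIntegral_gueDensity_pos (k := k) x
  have hy := setIntegral_gueDensity_pos (k := k) y
  have hdiff := (integrable_gaussApproxDet (k := k) hN).sub integrable_gueDensity
  rw [div_sub_one hy.ne', abs_div, abs_of_pos hy]
  refine div_le_div₀ (integral_nonneg fun _ => abs_nonneg _) ?_ hx
    (setIntegral_mono_set integrable_gueDensity.integrableOn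
      (ae_of_all _ fun h => (gueDensity_pos h).le) (shiftedCone_mono hxy).eventuallyLE)
  rw [← integral_sub (integrable_gaussApproxDet hN).integrableOn integrable_gueDensity.integrableOn]
  exact abs_integral_le_integral_abs.trans
    (setIntegral_le_integral hdiff.abs (ae_of_all _ fun h => abs_nonneg _))

theorem neg_le_mul_one_sub_sq {L r t : ℝ} (hr : 1 ≤ r) (ht₀ : 0 ≤ t) (ht : t ≤ 1 + L / r) :
    -(2 * L + L ^ 2) ≤ r * (1 - t ^ 2) := by
  calc -(2 * L + L ^ 2)
      ≤ -(2 * L + L ^ 2 / r) := by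
        gcongr
        exact div_le_self (sq_nonneg L) hr
    _ = r * (1 - (1 + L / r) ^ 2) := by
        field_simp
        ring
    _ ≤ r * (1 - t ^ 2) := by gcongr

end Asymptotics

end

theorem mainTheorem1 (L : ℝ) (hL : 0 < L) (k : ℕ) :
    ∀ ε : ℝ, 0 < ε → ∀ᶠ N : ℕ in atTop,
      ∀ z ∈ Metric.closedBall (0 : ℂ) (1 + L / Real.sqrt N),
        ∃ δ : ℝ, |δ| ≤ ε ∧
          ginibreMoment N k z =
            Real.exp ((N : ℝ) * k * (‖z‖ ^ 2 - 1) + (k : ℝ) ^ 2 / 2 * Real.log N) *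
              ((2 * Real.pi) ^ ((k : ℝ) / 2) / barnesG (1 + k)) *
              gueMaxCDF k (Real.sqrt N * (1 - ‖z‖ ^ 2)) * (1 + δ) := by
  intro ε hε
  have hlim := (tendsto_integral_abs_gaussApproxDet_sub k).div_const
    (∫ h in shiftedCone k (-(2 * L + L ^ 2)), gueDensity h)
  rw [zero_div] at hlim
  filter_upwards [hlim.eventually_le_const hε, eventually_gt_atTop 0] with N hNε hN z hz
  have hx : -(2 * L + L ^ 2) ≤ Real.sqrt N * (1 - ‖z‖ ^ 2) :=
    neg_le_mul_one_sub_sq (Real.one_le_sqrt.2 (by exact_mod_cast hN)) (norm_nonneg z)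
      (mem_closedBall_zero_iff.1 hz)
  refine ⟨_, (abs_setIntegral_div_sub_one_le hN hx).trans hNε, ?_⟩
  rw [add_sub_cancel, ginibreMoment_eq_mul hN]
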